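/- **Setting.** Let $\mathcal K$ be the set of nonempty open double cones of four-dimensional Minkowski spacetime, and write $a\perp b$ for spacelike separation. Let $\mathcal H_o$ be an infinite dimensional separable complex Hilbert space and let $\mathfrak A:\mathcal K\ni a\mapsto\mathfrak A(a)\subset\mathfrak B(\mathcal H_o)$ be a net of von Neumann algebras satisfying isotony ($a\subseteq b\Rightarrow\mathfrak A(a)\subseteq\mathfrak A(b)$), locality ($a\perp b\Rightarrow\mathfrak A(a)\subseteq\mathfrak A(b)'$) and Haag duality ($\mathfrak A(a^\perp)'=\mathfrak A(a)$ for all $a\in\mathcal K$, where $a^\perp$ is the spacelike complement of $a$ and $\mathfrak A(S)$ is the C*-algebra generated by all $\mathfrak A(b)$ with $b\in\mathcal K$, $b\subset S$). Let $\mathfrak A$ also denote the C*-algebra generated by all $\mathfrak A(a)$, $a\in\mathcal K$, and assume that it is irreducible. A *-morphism $\rho:\mathfrak A\to\mathfrak B(\mathcal H_o)\otimes\mathbb M_{n_\rho}$ (not necessarily unital) is *localized in* $o\in\mathcal K$ if $\rho(A)=(A\otimes 1_{n_\rho})\rho(1)$ for all $A\in\mathfrak A(a)$ and all $a\in\mathcal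 K$, $a\perp o$. The set $(\rho,\sigma)$ of intertwiners consists of the $T\in\mathfrak B(\mathcal H_o\otimes\mathbb C^{n_\rho},\mathcal H_o\otimes\mathbb C^{n_\sigma})$ with $T\rho(1)=T=\sigma(1)T$ and $T\rho(A)=\sigma(A)T$ for all $A\in\mathfrak A$. Such a $T$ is *unitary* if $T^+T=\rho(1)$ and $TT^+=\sigma(1)$, where $T^+$ is the adjoint of $T$. A localized $\rho$ is *transportable* if for each $o\in\mathcal K$ there are a morphism $\tau$ localized in $o$ and a unitary $U\in(\rho,\tau)$. The category $\mathcal B(\mathfrak A)$ has the localized transportable morphisms as objects, the intertwiners as arrows, the operator product as composition and $1_\rho=\rho(1)$ as units. Its (strict) tensor product is given, with $i=i_1+n_\rho i_2$ and $j=j_1+n_\rho j_2$, by $\rho\sigma(A)_{i,j}=\rho(\sigma(A)_{i_2,j_2})_{i_1,j_1}$ on objects. On arrows $T\in(\rho_1,\rho_2)$, $S\in(\sigma_1,\sigma_2)$ it is given, with $i=i_1+n_{\rho_2}i_2$ and $j=j_1+n_{\rho_1}j_2$, by $(T\times S)_{i,j}=\sum_k T_{i_1,k}\,\rho_1(S_{i_2,j_2})_{k,j_1}$.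 A *symmetry* of $\mathcal B(\mathfrak A)$ is a map $(\rho,\sigma)\mapsto\varepsilon(\rho,\sigma)\in(\rho\sigma,\sigma\rho)$ on pairs of objects such that, for all objects $\rho,\sigma,\tau,\beta$ and all $T\in(\tau,\rho)$, $S\in(\beta,\sigma)$, 1. $\varepsilon(\rho,\sigma)\cdot(T\times S)=(S\times T)\cdot\varepsilon(\tau,\beta)$, 2. $\varepsilon(\rho,\sigma)^+=\varepsilon(\sigma,\rho)$, 3. $\varepsilon(\rho,\tau\sigma)=(1_\tau\times\varepsilon(\rho,\sigma))\cdot(\varepsilon(\rho,\tau)\times1_\sigma)$, 4. $\varepsilon(\rho,\sigma)\cdot\varepsilon(\sigma,\rho)=1_{\sigma\rho}$. Let $\theta(n,m)$ be the permutation matrix with scalar entries that exchanges the two factors of an $n$-by-$m$ product index. Its entry in row $i=i_2'+m\,i_1'$ and column $j=j_1+n\,j_2$ is $1$ if $i_1'=j_1$ and $i_2'=j_2$, and $0$ otherwise ($0\le i_1',j_1<n$, $0\le i_2',j_2<m$). **Theorem.** The category $\mathcal B(\mathfrak A)$ has a unique symmetry $\varepsilon$ such that $$\varepsilon(\rho,\sigma)=\theta(n_\rho,n_\sigma)\cdot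 1_{\rho\sigma}$$ whenever $\rho$ and $\sigma$ are localized in mutually spacelike double cones. Moreover, for all objects $\rho,\sigma$ there are objects $\rho_1,\sigma_1$ localized in mutually spacelike double cones and unitaries $U\in(\rho,\rho_1)$, $V\in(\sigma,\sigma_1)$, and for every such choice $$\varepsilon(\rho,\sigma)=(V^+\times U^+)\cdot\theta(n_{\rho_1},n_{\sigma_1})\cdot(U\times V).$$ -/

import Mathlib

namespace DHR

noncomputable section

/-! ### Minkowski spacetime and double cones -/

/-- Four-dimensional Minkowski spacetime: a point is a pair (time, position). -/
abbrev Minkowski : Type := ℝ × EuclideanSpace ℝ (Fin 3)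

/-- The open forward light cone. -/
def forwardCone : Set Minkowski := {x | ‖x.2‖ < x.1}

/-- The vector `x` is spacelike. -/
def IsSpacelike (x : Minkowski) : Prop := x.1 ^ 2 - ‖x.2‖ ^ 2 < 0

/-- A (nonempty) open double cone, given by its past tip and its future tip. -/
structure DoubleCone where
  past : Minkowski
  future : Minkowski
  tips : future - past ∈ forwardCone

/-- The points of a double cone: the intersection of the open future of the past tip
with the open past of the future tip. -/
def DoubleCone.carrier (a : DoubleCone) : Set Minkowski :=
  {x | x - a.past ∈ forwardCone ∧ a.future - x ∈ forwardCone}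

/-- Spacelike complement of a region. -/
def spacelikeComplement (S : Set Minkowski) : Set Minkowski :=
  {x | ∀ y ∈ S, IsSpacelike (x - y)}

/-- Spacelike separation of double cones. -/
def DoubleCone.Perp (a b : DoubleCone) : Prop :=
  ∀ x ∈ a.carrier, ∀ y ∈ b.carrier, IsSpacelike (x - y)

theorem forwardCone_add {x y : Minkowski} (hx : x ∈ forwardCone) (hy : y ∈ forwardCone) :
    x + y ∈ forwardCone := by
  simp only [forwardCone, Set.mem_ofPred_eq, Prod.fst_add, Prod.snd_add] at *
  exact lt_of_le_of_lt (norm_add_le _ _) (add_lt_add hx hy)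

theorem DoubleCone.carrier_nonempty (a : DoubleCone) : a.carrier.Nonempty := by
  have key : (2⁻¹ : ℝ) • (a.future - a.past) ∈ forwardCone := by
    have h := a.tips
    simp only [forwardCone, Set.mem_ofPred_eq, Prod.smul_fst, Prod.smul_snd, norm_smul] at *
    rw [Real.norm_of_nonneg (by norm_num), smul_eq_mul]
    linarith
  refine ⟨a.past + (2⁻¹ : ℝ) • (a.future - a.past), ?_, ?_⟩
  · simpa using key
  · have : a.future - (a.past + (2⁻¹ : ℝ) • (a.future - a.past))
        = (2⁻¹ : ℝ) • (a.future - a.past) := by module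
    rw [this]; exact key

theorem DoubleCone.exists_upper (a b : DoubleCone) :
    ∃ c : DoubleCone, a.carrier ⊆ c.carrier ∧ b.carrier ⊆ c.carrier := by
  set R : ℝ := 1 + (‖a.past.2‖ + |a.past.1|) + (‖a.future.2‖ + |a.future.1|)
    + (‖b.past.2‖ + |b.past.1|) + (‖b.future.2‖ + |b.future.1|) with hR
  have hp : ∀ x : Minkowski, ‖x.2‖ + |x.1| < R → x - (-R, 0) ∈ forwardCone := by
    intro x hx
    simp only [forwardCone, Set.mem_ofPred_eq, Prod.fst_sub, Prod.snd_sub, sub_zero]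
    have := neg_abs_le x.1
    linarith
  have hf : ∀ x : Minkowski, ‖x.2‖ + |x.1| < R → (R, 0) - x ∈ forwardCone := by
    intro x hx
    simp only [forwardCone, Set.mem_ofPred_eq, Prod.fst_sub, Prod.snd_sub, zero_sub, norm_neg]
    have := le_abs_self x.1
    linarith
  have e1 := norm_nonneg a.past.2
  have e2 := norm_nonneg a.future.2
  have e3 := norm_nonneg b.past.2
  have e4 := norm_nonneg b.future.2
  have e5 := abs_nonneg a.past.1
  have e6 := abs_nonneg a.future.1
  have e7 := abs_nonneg b.past.1
  have e8 := abs_nonneg b.future.1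
  refine ⟨⟨(-R, 0), (R, 0), ?_⟩, ?_, ?_⟩
  · simp only [forwardCone, Set.mem_ofPred_eq, Prod.fst_sub, Prod.snd_sub, sub_zero, norm_zero]
    linarith
  · rintro x ⟨h1, h2⟩
    refine ⟨?_, ?_⟩
    · have := forwardCone_add h1 (hp a.past (by linarith))
      simpa using this
    · have := forwardCone_add h2 (hf a.future (by linarith))
      simpa using this
  · rintro x ⟨h1, h2⟩
    refine ⟨?_, ?_⟩
    · have := forwardCone_add h1 (hp b.past (by linarith))
      simpa using this
    · have := forwardCone_add h2 (hf b.future (by linarith))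
      simpa using this

theorem DoubleCone.Perp.mono_right {a b c : DoubleCone} (h : a.Perp c)
    (hbc : b.carrier ⊆ c.carrier) : a.Perp b :=
  fun x hx y hy => h x hx y (hbc hy)

/-! ### Nets of von Neumann algebras -/

section Net

variable {H : Type*} [NormedAddCommGroup H] [InnerProductSpace ℂ H] [CompleteSpace H]

/-- A local net of von Neumann algebras on `H` over the double cones of Minkowski spacetime. -/
structure LocalNet (H : Type*) [NormedAddCommGroup H] [InnerProductSpace ℂ H]
    [CompleteSpace H] where
  alg : DoubleCone → VonNeumannAlgebra H
  isotony : ∀ a b : DoubleCone, a.carrier ⊆ b.carrier →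
    (alg a : Set (H →L[ℂ] H)) ⊆ (alg b : Set (H →L[ℂ] H))
  locality : ∀ a b : DoubleCone, a.Perp b →
    (alg a : Set (H →L[ℂ] H)) ⊆ Set.centralizer (alg b : Set (H →L[ℂ] H))

/-- The C*-algebra of a region `S`: it is generated by the algebras of the double cones
contained in `S`. -/
def LocalNet.region (N : LocalNet H) (S : Set Minkowski) : StarSubalgebra ℂ (H →L[ℂ] H) :=
  (StarAlgebra.adjoin ℂ
    {A : H →L[ℂ] H | ∃ a : DoubleCone, a.carrier ⊆ S ∧ A ∈ N.alg a}).topologicalClosure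

/-- The C*-algebra of the whole spacetime. -/
def LocalNet.quasilocal (N : LocalNet H) : StarSubalgebra ℂ (H →L[ℂ] H) :=
  N.region Set.univ

/-- A net of local observables in a reference representation: an irreducible local net of
von Neumann algebras which satisfies Haag duality. -/
structure ReferenceNet (H : Type*) [NormedAddCommGroup H] [InnerProductSpace ℂ H]
    [CompleteSpace H] extends LocalNet H where
  irreducible : ∀ T ∈ Set.centralizer (toLocalNet.quasilocal : Set (H →L[ℂ] H)),
    ∃ c : ℂ, T = c • (1 : H →L[ℂ] H)
  haag_duality : ∀ a : DoubleCone,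
    Set.centralizer (toLocalNet.region (spacelikeComplement a.carrier) : Set (H →L[ℂ] H))
      = (alg a : Set (H →L[ℂ] H))

/-! ### Localized transportable morphisms -/

/-- A morphism from the quasilocal C*-algebra to the `mult` by `mult` matrices over the bounded
operators; it need not be unital. -/
structure NetMorphism (N : ReferenceNet H) where
  mult : ℕ
  hom : N.quasilocal →⋆ₙₐ[ℂ] Matrix (Fin mult) (Fin mult) (H →L[ℂ] H)

/-- The matrix `A ⊗ 1ₙ`. -/
def ampliation (n : ℕ) (A : H →L[ℂ] H) : Matrix (Fin n) (Fin n) (H →L[ℂ] H) :=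
  Matrix.diagonal fun _ => A

variable {N : ReferenceNet H}

/-- `ρ` is localized in the double cone `o`. -/
def NetMorphism.LocalizedIn (ρ : NetMorphism N) (o : DoubleCone) : Prop :=
  ∀ a : DoubleCone, a.Perp o → ∀ A : N.quasilocal, (A : H →L[ℂ] H) ∈ N.alg a →
    ρ.hom A = ampliation ρ.mult (A : H →L[ℂ] H) * ρ.hom 1

/-- Intertwiners from `ρ` to `σ`. An operator from `H ⊗ ℂⁿ` to `H ⊗ ℂᵐ` is written as
an `m` by `n` matrix of operators on `H`. -/
structure IsIntertwiner (ρ σ : NetMorphism N)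
    (T : Matrix (Fin σ.mult) (Fin ρ.mult) (H →L[ℂ] H)) : Prop where
  mul_one : T * ρ.hom 1 = T
  one_mul : σ.hom 1 * T = T
  intertwines : ∀ A : N.quasilocal, T * ρ.hom A = σ.hom A * T

/-- Unitary intertwiners: the units are the projections `ρ(1)` and `σ(1)`. -/
structure IsUnitaryIntertwiner (ρ σ : NetMorphism N)
    (U : Matrix (Fin σ.mult) (Fin ρ.mult) (H →L[ℂ] H)) : Prop extends IsIntertwiner ρ σ U where
  adjoint_mul : U.conjTranspose * U = ρ.hom 1
  mul_adjoint : U * U.conjTranspose = σ.hom 1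

/-- A morphism is transportable if it is unitarily equivalent to morphisms localized in
arbitrary double cones. -/
def NetMorphism.Transportable (ρ : NetMorphism N) : Prop :=
  ∀ o : DoubleCone, ∃ τ : NetMorphism N, τ.LocalizedIn o ∧
    ∃ U : Matrix (Fin τ.mult) (Fin ρ.mult) (H →L[ℂ] H), IsUnitaryIntertwiner ρ τ U

/-! ### The category of localized transportable bimodules -/

/-- The objects: the localized transportable morphisms. -/
structure LTBimod (N : ReferenceNet H) extends NetMorphism N where
  localized : ∃ o : DoubleCone, toNetMorphism.LocalizedIn o
  transportable : toNetMorphism.Transportable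

/-- The arrows: the intertwiners. -/
@[ext]
structure LTBimod.Hom (ρ σ : LTBimod N) where
  mat : Matrix (Fin σ.mult) (Fin ρ.mult) (H →L[ℂ] H)
  isIntertwiner : IsIntertwiner ρ.toNetMorphism σ.toNetMorphism mat

theorem IsIntertwiner.id (ρ : NetMorphism N) : IsIntertwiner ρ ρ (ρ.hom 1) where
  mul_one := by rw [← map_mul, _root_.mul_one]
  one_mul := by rw [← map_mul, _root_.mul_one]
  intertwines A := by rw [← map_mul, ← map_mul, _root_.mul_one, _root_.one_mul]

theorem IsIntertwiner.comp {ρ σ τ : NetMorphism N}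
    {T : Matrix (Fin σ.mult) (Fin ρ.mult) (H →L[ℂ] H)}
    {S : Matrix (Fin τ.mult) (Fin σ.mult) (H →L[ℂ] H)}
    (hT : IsIntertwiner ρ σ T) (hS : IsIntertwiner σ τ S) : IsIntertwiner ρ τ (S * T) where
  mul_one := by rw [Matrix.mul_assoc, hT.mul_one]
  one_mul := by rw [← Matrix.mul_assoc, hS.one_mul]
  intertwines A := by
    rw [Matrix.mul_assoc, hT.intertwines, ← Matrix.mul_assoc, hS.intertwines, Matrix.mul_assoc]

theorem NetMorphism.conjTranspose_hom (ρ : NetMorphism N) (A : N.quasilocal) :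
    (ρ.hom A).conjTranspose = ρ.hom (star A) := by
  rw [map_star]; rfl

theorem IsIntertwiner.adjoint {ρ σ : NetMorphism N}
    {T : Matrix (Fin σ.mult) (Fin ρ.mult) (H →L[ℂ] H)}
    (hT : IsIntertwiner ρ σ T) : IsIntertwiner σ ρ T.conjTranspose where
  mul_one := by
    have h := congrArg Matrix.conjTranspose hT.one_mul
    rwa [Matrix.conjTranspose_mul, NetMorphism.conjTranspose_hom, star_one] at h
  one_mul := by
    have h := congrArg Matrix.conjTranspose hT.mul_one
    rwa [Matrix.conjTranspose_mul, NetMorphism.conjTranspose_hom, star_one] at h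
  intertwines A := by
    have h := congrArg Matrix.conjTranspose (hT.intertwines (star A))
    rw [Matrix.conjTranspose_mul, Matrix.conjTranspose_mul, NetMorphism.conjTranspose_hom,
      NetMorphism.conjTranspose_hom, star_star] at h
    exact h.symm

open CategoryTheory in
/-- The category of localized transportable bimodules of the net. The identity of `ρ` is `ρ(1)`
and composition is the product of matrices (`f ≫ g` is the product `g * f`). -/
instance : Category (LTBimod N) where
  Hom := LTBimod.Hom
  id ρ := ⟨ρ.hom 1, IsIntertwiner.id _⟩
  comp f g := ⟨g.mat * f.mat, f.isIntertwiner.comp g.isIntertwiner⟩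
  id_comp f := LTBimod.Hom.ext f.isIntertwiner.mul_one
  comp_id f := LTBimod.Hom.ext f.isIntertwiner.one_mul
  assoc _ _ _ := LTBimod.Hom.ext (Matrix.mul_assoc _ _ _).symm

/-- The adjoint of an arrow. -/
def LTBimod.adj {ρ σ : LTBimod N} (f : ρ ⟶ σ) : σ ⟶ ρ :=
  ⟨f.mat.conjTranspose, f.isIntertwiner.adjoint⟩

/-! ### The values of morphisms and intertwiners lie in the quasilocal algebra -/

theorem LocalNet.alg_le_quasilocal (N : LocalNet H) (a : DoubleCone) {A : H →L[ℂ] H}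
    (hA : A ∈ N.alg a) : A ∈ N.quasilocal :=
  (StarSubalgebra.le_topologicalClosure _)
    (StarAlgebra.subset_adjoin ℂ _ ⟨a, Set.subset_univ _, hA⟩)

/-- By Haag duality an operator which commutes with the algebras of all the double cones
spacelike to `a` belongs to the algebra of `a`. -/
theorem ReferenceNet.mem_alg_of_commute (N : ReferenceNet H) (a : DoubleCone) {T : H →L[ℂ] H}
    (hT : ∀ b : DoubleCone, b.Perp a → ∀ B ∈ N.alg b, B * T = T * B) : T ∈ N.alg a := by
  have h : T ∈ Set.centralizer
      (N.region (spacelikeComplement a.carrier) : Set (H →L[ℂ] H)) := by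
    have hle : N.region (spacelikeComplement a.carrier) ≤ StarSubalgebra.centralizer ℂ {T} := by
      refine StarSubalgebra.topologicalClosure_minimal (StarAlgebra.adjoin_le ?_) ?_
      · rintro B ⟨b, hb, hB⟩
        have hperp : b.Perp a := fun x hx y hy => hb hx y hy
        refine StarSubalgebra.mem_centralizer_iff ℂ |>.2 ?_
        rintro S rfl
        refine ⟨(hT b hperp B hB).symm, ?_⟩
        have h := congrArg star (hT b hperp (star B) (star_mem hB))
        rw [star_mul, star_mul, star_star] at h
        exact h
      · rw [StarSubalgebra.coe_centralizer]
        exact Set.isClosed_centralizer _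
    intro B hB
    exact ((StarSubalgebra.mem_centralizer_iff ℂ).1 (hle hB) T rfl).1.symm
  rw [N.haag_duality a] at h
  exact h

theorem ampliation_mul_apply {n m : ℕ} (A : H →L[ℂ] H)
    (M : Matrix (Fin n) (Fin m) (H →L[ℂ] H)) (i : Fin n) (j : Fin m) :
    (ampliation n A * M) i j = A * M i j :=
  Matrix.diagonal_mul _ _ _ _

theorem mul_ampliation_apply {n m : ℕ} (A : H →L[ℂ] H)
    (M : Matrix (Fin n) (Fin m) (H →L[ℂ] H)) (i : Fin n) (j : Fin m) :
    (M * ampliation m A) i j = M i j * A :=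
  Matrix.mul_diagonal _ _ _ _

theorem NetMorphism.LocalizedIn.eq_mul_ampliation {ρ : NetMorphism N} {o : DoubleCone}
    (h : ρ.LocalizedIn o) {a : DoubleCone} (ha : a.Perp o) (A : N.quasilocal)
    (hA : (A : H →L[ℂ] H) ∈ N.alg a) :
    ρ.hom A = ρ.hom 1 * ampliation ρ.mult (A : H →L[ℂ] H) := by
  have h1 := congrArg Matrix.conjTranspose (h a ha (star A) (star_mem hA))
  rw [Matrix.conjTranspose_mul, conjTranspose_hom, conjTranspose_hom, star_star, star_one] at h1
  rw [h1, ampliation, ampliation, Matrix.diagonal_conjTranspose]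
  congr 2
  funext i
  simp

theorem NetMorphism.LocalizedIn.mono {ρ : NetMorphism N} {o c : DoubleCone}
    (h : ρ.LocalizedIn o) (hoc : o.carrier ⊆ c.carrier) : ρ.LocalizedIn c :=
  fun a ha A hA => h a (ha.mono_right hoc) A hA

theorem IsIntertwiner.mem_alg {ρ σ : NetMorphism N}
    {T : Matrix (Fin σ.mult) (Fin ρ.mult) (H →L[ℂ] H)} (hT : IsIntertwiner ρ σ T)
    {c : DoubleCone} (hρ : ρ.LocalizedIn c) (hσ : σ.LocalizedIn c) (i : Fin σ.mult)
    (j : Fin ρ.mult) : T i j ∈ N.alg c := by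
  refine N.mem_alg_of_commute c fun b hb B hB => ?_
  have h := hT.intertwines ⟨B, N.alg_le_quasilocal b hB⟩
  rw [hσ b hb _ hB, hρ.eq_mul_ampliation hb _ hB, ← Matrix.mul_assoc, hT.mul_one,
    Matrix.mul_assoc, hT.one_mul] at h
  have h2 := congrFun (congrFun h i) j
  rw [mul_ampliation_apply, ampliation_mul_apply] at h2
  exact h2.symm

theorem NetMorphism.LocalizedIn.hom_mem_alg {ρ : NetMorphism N} {c : DoubleCone}
    (hρ : ρ.LocalizedIn c) (A : N.quasilocal) (hA : (A : H →L[ℂ] H) ∈ N.alg c)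
    (i j : Fin ρ.mult) : ρ.hom A i j ∈ N.alg c := by
  refine N.mem_alg_of_commute c fun b hb B hB => ?_
  set B' : N.quasilocal := ⟨B, N.alg_le_quasilocal b hB⟩ with hB'
  have hcomm : A * B' = B' * A := by
    apply Subtype.ext
    exact (N.locality b c hb hB _ hA)
  have h : ρ.hom A * ρ.hom B' = ρ.hom B' * ρ.hom A := by
    rw [← map_mul, ← map_mul, hcomm]
  rw [hρ b hb B' hB, Matrix.mul_assoc, ← map_mul ρ.hom 1 A, one_mul,
    ← hρ b hb B' hB, hρ.eq_mul_ampliation hb B' hB, ← Matrix.mul_assoc, ← map_mul ρ.hom A 1,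
    mul_one] at h
  have h2 := congrFun (congrFun h i) j
  rw [mul_ampliation_apply, ampliation_mul_apply] at h2
  exact h2.symm

theorem NetMorphism.continuous_entry (ρ : NetMorphism N) (i j : Fin ρ.mult) :
    Continuous fun A : N.quasilocal => ρ.hom A i j := by
  have hcl : IsClosed (N.quasilocal : Set (H →L[ℂ] H)) :=
    StarSubalgebra.isClosed_topologicalClosure _
  let _ : CStarAlgebra N.quasilocal := StarSubalgebra.cstarAlgebra _ (h_closed := hcl)
  let φ : N.quasilocal →⋆ₙₐ[ℂ] CStarMatrix (Fin ρ.mult) (Fin ρ.mult) (H →L[ℂ] H) :=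
    (CStarMatrix.ofMatrixStarAlgEquiv : _ ≃⋆ₐ[ℂ] _).toStarAlgHom.toNonUnitalStarAlgHom.comp ρ.hom
  have hφ : Continuous φ :=
    AddMonoidHomClass.continuous_of_bound φ 1 fun A => by
      simpa only [one_mul] using NonUnitalStarAlgHom.norm_apply_le φ A
  have h2 : Continuous fun M : CStarMatrix (Fin ρ.mult) (Fin ρ.mult) (H →L[ℂ] H) => M i j :=
    (continuous_apply j).comp (continuous_apply i)
  exact h2.comp hφ

/-- The entries of the values of `ρ` lie in the quasilocal algebra. -/
def NetMorphism.Valued (ρ : NetMorphism N) : Prop :=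
  ∀ (A : N.quasilocal) (i j : Fin ρ.mult), ρ.hom A i j ∈ N.quasilocal

theorem NetMorphism.LocalizedIn.valued {ρ : NetMorphism N} {o : DoubleCone}
    (hρ : ρ.LocalizedIn o) : ρ.Valued := by
  have hcl : IsClosed (N.quasilocal : Set (H →L[ℂ] H)) :=
    StarSubalgebra.isClosed_topologicalClosure _
  have key : ∀ x : H →L[ℂ] H, x ∈ StarAlgebra.adjoin ℂ
      {A : H →L[ℂ] H | ∃ a : DoubleCone, a.carrier ⊆ Set.univ ∧ A ∈ N.alg a} →
      ∃ hx : x ∈ N.quasilocal, ∀ i j, ρ.hom ⟨x, hx⟩ i j ∈ N.quasilocal := by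
    intro x hx
    induction hx using StarAlgebra.adjoin_induction with
    | mem x hx =>
      obtain ⟨a, -, ha⟩ := hx
      obtain ⟨c, hac, hoc⟩ := a.exists_upper o
      exact ⟨N.alg_le_quasilocal a ha, fun i j => N.alg_le_quasilocal c
        ((hρ.mono hoc).hom_mem_alg _ (N.isotony a c hac ha) i j)⟩
    | algebraMap r =>
      refine ⟨algebraMap_mem _ r, fun i j => ?_⟩
      have h1 : ρ.hom ⟨algebraMap ℂ (H →L[ℂ] H) r, algebraMap_mem _ r⟩ = r • ρ.hom 1 := by
        rw [← map_smul]
        exact congrArg ρ.hom (Subtype.ext (Algebra.algebraMap_eq_smul_one r))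
      rw [h1, Matrix.smul_apply]
      exact SMulMemClass.smul_mem r (N.alg_le_quasilocal o
        (hρ.hom_mem_alg 1 (one_mem (N.alg o)) i j))
    | add x y _ _ hx hy =>
      obtain ⟨hx, hx2⟩ := hx
      obtain ⟨hy, hy2⟩ := hy
      refine ⟨add_mem hx hy, fun i j => ?_⟩
      have h1 : ρ.hom ⟨x + y, add_mem hx hy⟩ = ρ.hom ⟨x, hx⟩ + ρ.hom ⟨y, hy⟩ := by
        rw [← map_add]; rfl
      rw [h1]
      exact add_mem (hx2 i j) (hy2 i j)
    | mul x y _ _ hx hy =>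
      obtain ⟨hx, hx2⟩ := hx
      obtain ⟨hy, hy2⟩ := hy
      refine ⟨mul_mem hx hy, fun i j => ?_⟩
      have h1 : ρ.hom ⟨x * y, mul_mem hx hy⟩ = ρ.hom ⟨x, hx⟩ * ρ.hom ⟨y, hy⟩ := by
        rw [← map_mul]; rfl
      rw [h1, Matrix.mul_apply]
      exact sum_mem fun k _ => mul_mem (hx2 i k) (hy2 k j)
    | star x _ hx =>
      obtain ⟨hx, hx2⟩ := hx
      refine ⟨star_mem hx, fun i j => ?_⟩
      have h1 : ρ.hom ⟨star x, star_mem hx⟩ = (ρ.hom ⟨x, hx⟩).conjTranspose := by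
        rw [NetMorphism.conjTranspose_hom]; rfl
      rw [h1]
      exact star_mem (hx2 j i)
  rintro ⟨A, hA⟩ i j
  obtain ⟨u, hu, hlim⟩ := mem_closure_iff_seq_limit.1 hA
  choose hm he using fun n => key (u n) (hu n)
  have hlim' : Filter.Tendsto (fun n => (⟨u n, hm n⟩ : N.quasilocal)) Filter.atTop
      (nhds ⟨A, hA⟩) := tendsto_subtype_rng.2 hlim
  exact hcl.mem_of_tendsto (((ρ.continuous_entry i j).tendsto _).comp hlim')
    (Filter.Eventually.of_forall fun n => he n i j)

theorem LTBimod.valued (ρ : LTBimod N) : ρ.toNetMorphism.Valued :=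
  ρ.localized.elim fun _ h => h.valued

theorem IsIntertwiner.mem_quasilocal {ρ σ : NetMorphism N}
    {T : Matrix (Fin σ.mult) (Fin ρ.mult) (H →L[ℂ] H)} (hT : IsIntertwiner ρ σ T)
    (hρ : ∃ o, ρ.LocalizedIn o) (hσ : ∃ o, σ.LocalizedIn o) (i : Fin σ.mult)
    (j : Fin ρ.mult) : T i j ∈ N.quasilocal := by
  obtain ⟨a, ha⟩ := hρ
  obtain ⟨b, hb⟩ := hσ
  obtain ⟨c, hac, hbc⟩ := a.exists_upper b
  exact N.alg_le_quasilocal c (hT.mem_alg (ha.mono hac) (hb.mono hbc) i j)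

/-! ### The tensor product -/

/-- Apply `ρ` to every entry of an `m` by `n` matrix over the quasilocal algebra. The result is
a matrix of operators, whose index `i` corresponds to the pair `(i₁, i₂)` with
`i = i₁ + n_ρ * i₂` (that is, `i₁ = i.modNat` and `i₂ = i.divNat`). -/
def NetMorphism.onMatrix (ρ : NetMorphism N) {m n : ℕ} (S : Matrix (Fin m) (Fin n) N.quasilocal) :
    Matrix (Fin (m * ρ.mult)) (Fin (n * ρ.mult)) (H →L[ℂ] H) :=
  Matrix.of fun i j => ρ.hom (S i.divNat j.divNat) i.modNat j.modNat

/-- The values of `ρ`, as matrices over the quasilocal algebra. -/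
def NetMorphism.value (ρ : NetMorphism N) (hρ : ρ.Valued) (A : N.quasilocal) :
    Matrix (Fin ρ.mult) (Fin ρ.mult) N.quasilocal :=
  Matrix.of fun i j => ⟨ρ.hom A i j, hρ A i j⟩

theorem sum_divNat_modNat {M : Type*} [AddCommMonoid M] {m n : ℕ} (f : Fin m → Fin n → M) :
    ∑ k : Fin (m * n), f k.divNat k.modNat = ∑ a, ∑ b, f a b := by
  rw [← Fintype.sum_prod_type' f, ← finProdFinEquiv.symm.sum_comp]
  rfl

theorem NetMorphism.onMatrix_mul (ρ : NetMorphism N) {l m n : ℕ}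
    (S : Matrix (Fin l) (Fin m) N.quasilocal) (T : Matrix (Fin m) (Fin n) N.quasilocal) :
    ρ.onMatrix (S * T) = ρ.onMatrix S * ρ.onMatrix T := by
  ext1 i j
  simp only [onMatrix, Matrix.of_apply, Matrix.mul_apply, map_sum, map_mul, Matrix.sum_apply]
  exact (sum_divNat_modNat fun a b =>
    ρ.hom (S i.divNat a) i.modNat b * ρ.hom (T a j.divNat) b j.modNat).symm

/-- The product `ρσ` of two morphisms: `ρσ(A)ᵢⱼ = ρ(σ(A)_{i₂ j₂})_{i₁ j₁}`, where
`i = i₁ + n_ρ * i₂` and `j = j₁ + n_ρ * j₂`. -/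
def NetMorphism.tensor (ρ σ : NetMorphism N) (hσ : σ.Valued) : NetMorphism N where
  mult := σ.mult * ρ.mult
  hom :=
    { toFun := fun A => ρ.onMatrix (σ.value hσ A)
      map_smul' := fun c A => by
        have h : σ.value hσ (c • A) = c • σ.value hσ A := by
          ext1 i j
          apply Subtype.ext
          simp [value]
        ext1 i j
        simp [h, onMatrix]
      map_zero' := by
        have h : σ.value hσ 0 = 0 := by
          ext1 i j
          apply Subtype.ext
          simp [value]
        ext1 i j
        simp [h, onMatrix]
      map_add' := fun A B => by
        have h : σ.value hσ (A + B) = σ.value hσ A + σ.value hσ B := by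
          ext1 i j
          apply Subtype.ext
          simp [value]
        ext1 i j
        simp [h, onMatrix]
      map_mul' := fun A B => by
        have h : σ.value hσ (A * B) = σ.value hσ A * σ.value hσ B := by
          ext1 i j
          apply Subtype.ext
          simp [value, Matrix.mul_apply]
        rw [h, onMatrix_mul]
      map_star' := fun A => by
        have h : ∀ i j, σ.value hσ (star A) i j = star (σ.value hσ A j i) := by
          intro i j
          apply Subtype.ext
          simp [value, map_star, Matrix.star_apply]
        ext1 i j
        simp [h, onMatrix, map_star, Matrix.star_apply] }

/-- The entries of an arrow, as elements of the quasilocal algebra. -/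
def LTBimod.Hom.value {ρ σ : LTBimod N} (f : ρ ⟶ σ) :
    Matrix (Fin σ.mult) (Fin ρ.mult) N.quasilocal :=
  Matrix.of fun i j =>
    ⟨f.mat i j, f.isIntertwiner.mem_quasilocal ρ.localized σ.localized i j⟩

/-- The product of intertwiners `T` from `ρ₁` to `ρ₂` and `S` from `σ₁` to `σ₂`:
`(T × S)ᵢⱼ = ∑ₖ T_{i₁ k} ρ₁(S_{i₂ j₂})_{k j₁}`, where `i = i₁ + n_{ρ₂} * i₂` and
`j = j₁ + n_{ρ₁} * j₂`. -/
def tensorMat (ρ₁ ρ₂ : NetMorphism N) {m n : ℕ}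
    (T : Matrix (Fin ρ₂.mult) (Fin ρ₁.mult) (H →L[ℂ] H))
    (S : Matrix (Fin m) (Fin n) N.quasilocal) :
    Matrix (Fin (m * ρ₂.mult)) (Fin (n * ρ₁.mult)) (H →L[ℂ] H) :=
  Matrix.of fun i j => ∑ k, T i.modNat k * ρ₁.hom (S i.divNat j.divNat) k j.modNat

theorem tensorMat_apply (ρ₁ ρ₂ : NetMorphism N) {m n : ℕ}
    (T : Matrix (Fin ρ₂.mult) (Fin ρ₁.mult) (H →L[ℂ] H))
    (S : Matrix (Fin m) (Fin n) N.quasilocal) (i : Fin (m * ρ₂.mult)) (j : Fin (n * ρ₁.mult)) :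
    tensorMat ρ₁ ρ₂ T S i j = (T * ρ₁.hom (S i.divNat j.divNat)) i.modNat j.modNat := rfl

theorem tensorMat_one (ρ : NetMorphism N) {m n : ℕ} (S : Matrix (Fin m) (Fin n) N.quasilocal) :
    tensorMat ρ ρ (ρ.hom 1) S = ρ.onMatrix S := by
  ext1 i j
  rw [tensorMat_apply, ← map_mul, one_mul]
  rfl

theorem tensorMat_mul {ρ₁ ρ₂ ρ₃ : NetMorphism N} {l m n : ℕ}
    {T : Matrix (Fin ρ₂.mult) (Fin ρ₁.mult) (H →L[ℂ] H)} (hT : IsIntertwiner ρ₁ ρ₂ T)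
    (T' : Matrix (Fin ρ₃.mult) (Fin ρ₂.mult) (H →L[ℂ] H))
    (S' : Matrix (Fin l) (Fin m) N.quasilocal) (S : Matrix (Fin m) (Fin n) N.quasilocal) :
    tensorMat ρ₂ ρ₃ T' S' * tensorMat ρ₁ ρ₂ T S = tensorMat ρ₁ ρ₃ (T' * T) (S' * S) := by
  ext1 i j
  have key : ∀ A B : N.quasilocal,
      (T' * ρ₂.hom A) * (T * ρ₁.hom B) = T' * T * ρ₁.hom (A * B) := by
    intro A B
    rw [map_mul, Matrix.mul_assoc, ← Matrix.mul_assoc (ρ₂.hom A), ← hT.intertwines]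
    simp only [Matrix.mul_assoc]
  rw [Matrix.mul_apply, tensorMat_apply]
  simp only [tensorMat_apply]
  rw [sum_divNat_modNat (fun a b => (T' * ρ₂.hom (S' i.divNat a)) i.modNat b *
    (T * ρ₁.hom (S a j.divNat)) b j.modNat)]
  simp only [← Matrix.mul_apply, key]
  rw [Matrix.mul_apply (M := S'), map_sum, Matrix.mul_sum, Matrix.sum_apply]

theorem tensorMat_conjTranspose {ρ₁ ρ₂ : NetMorphism N} {m n : ℕ}
    {T : Matrix (Fin ρ₂.mult) (Fin ρ₁.mult) (H →L[ℂ] H)} (hT : IsIntertwiner ρ₁ ρ₂ T)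
    (S : Matrix (Fin m) (Fin n) N.quasilocal) :
    (tensorMat ρ₁ ρ₂ T S).conjTranspose = tensorMat ρ₂ ρ₁ T.conjTranspose S.conjTranspose := by
  ext1 i j
  rw [Matrix.conjTranspose_apply, tensorMat_apply, tensorMat_apply, hT.intertwines,
    Matrix.conjTranspose_apply, ← NetMorphism.conjTranspose_hom, ← Matrix.conjTranspose_mul,
    Matrix.conjTranspose_apply]

theorem IsIntertwiner.mul_value {σ₁ σ₂ : NetMorphism N} (h₁ : σ₁.Valued) (h₂ : σ₂.Valued)
    {S : Matrix (Fin σ₂.mult) (Fin σ₁.mult) N.quasilocal}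
    (hS : IsIntertwiner σ₁ σ₂ (S.map Subtype.val)) (A : N.quasilocal) :
    S * σ₁.value h₁ A = σ₂.value h₂ A * S := by
  ext1 i j
  apply Subtype.ext
  have h := congrFun (congrFun (hS.intertwines A) i) j
  simpa [Matrix.mul_apply, NetMorphism.value] using h

theorem IsIntertwiner.mul_value_one {σ₁ σ₂ : NetMorphism N} (h₁ : σ₁.Valued)
    {S : Matrix (Fin σ₂.mult) (Fin σ₁.mult) N.quasilocal}
    (hS : IsIntertwiner σ₁ σ₂ (S.map Subtype.val)) : S * σ₁.value h₁ 1 = S := by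
  ext1 i j
  apply Subtype.ext
  have h := congrFun (congrFun hS.mul_one i) j
  simpa [Matrix.mul_apply, NetMorphism.value] using h

theorem IsIntertwiner.tensor {ρ₁ ρ₂ σ₁ σ₂ : NetMorphism N} (h₁ : σ₁.Valued) (h₂ : σ₂.Valued)
    {T : Matrix (Fin ρ₂.mult) (Fin ρ₁.mult) (H →L[ℂ] H)} (hT : IsIntertwiner ρ₁ ρ₂ T)
    {S : Matrix (Fin σ₂.mult) (Fin σ₁.mult) N.quasilocal}
    (hS : IsIntertwiner σ₁ σ₂ (S.map Subtype.val)) :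
    IsIntertwiner (ρ₁.tensor σ₁ h₁) (ρ₂.tensor σ₂ h₂) (tensorMat ρ₁ ρ₂ T S) := by
  have right : ∀ A, tensorMat ρ₁ ρ₂ T S * ρ₁.onMatrix (σ₁.value h₁ A)
      = tensorMat ρ₁ ρ₂ T (S * σ₁.value h₁ A) := by
    intro A
    rw [← tensorMat_one, tensorMat_mul (IsIntertwiner.id ρ₁), hT.mul_one]
  have left : ∀ A, ρ₂.onMatrix (σ₂.value h₂ A) * tensorMat ρ₁ ρ₂ T S
      = tensorMat ρ₁ ρ₂ T (σ₂.value h₂ A * S) := by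
    intro A
    rw [← tensorMat_one, tensorMat_mul hT, hT.one_mul]
  refine ⟨?_, ?_, fun A => ?_⟩
  · exact (right 1).trans (by rw [hS.mul_value_one h₁])
  · exact (left 1).trans (by rw [← hS.mul_value h₁ h₂, hS.mul_value_one h₁])
  · exact (right A).trans ((left A).trans (by rw [hS.mul_value h₁ h₂])).symm

theorem IsUnitaryIntertwiner.tensor {ρ₁ ρ₂ σ₁ σ₂ : NetMorphism N} (h₁ : σ₁.Valued)
    (h₂ : σ₂.Valued) {T : Matrix (Fin ρ₂.mult) (Fin ρ₁.mult) (H →L[ℂ] H)}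
    (hT : IsUnitaryIntertwiner ρ₁ ρ₂ T)
    {S : Matrix (Fin σ₂.mult) (Fin σ₁.mult) N.quasilocal}
    (hS : IsUnitaryIntertwiner σ₁ σ₂ (S.map Subtype.val)) :
    IsUnitaryIntertwiner (ρ₁.tensor σ₁ h₁) (ρ₂.tensor σ₂ h₂) (tensorMat ρ₁ ρ₂ T S) where
  toIsIntertwiner := hT.toIsIntertwiner.tensor h₁ h₂ hS.toIsIntertwiner
  adjoint_mul := by
    have h : S.conjTranspose * S = σ₁.value h₁ 1 := by
      ext1 i j
      apply Subtype.ext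
      have h := congrFun (congrFun hS.adjoint_mul i) j
      simpa [Matrix.mul_apply, NetMorphism.value] using h
    have h2 : (tensorMat ρ₁ ρ₂ T S).conjTranspose * tensorMat ρ₁ ρ₂ T S
        = ρ₁.onMatrix (σ₁.value h₁ 1) := by
      rw [tensorMat_conjTranspose hT.toIsIntertwiner, tensorMat_mul hT.toIsIntertwiner,
        hT.adjoint_mul, h, tensorMat_one]
    exact h2
  mul_adjoint := by
    have h : S * S.conjTranspose = σ₂.value h₂ 1 := by
      ext1 i j
      apply Subtype.ext
      have h := congrFun (congrFun hS.mul_adjoint i) j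
      simpa [Matrix.mul_apply, NetMorphism.value] using h
    have h2 : tensorMat ρ₁ ρ₂ T S * (tensorMat ρ₁ ρ₂ T S).conjTranspose
        = ρ₂.onMatrix (σ₂.value h₂ 1) := by
      rw [tensorMat_conjTranspose hT.toIsIntertwiner, tensorMat_mul hT.toIsIntertwiner.adjoint,
        hT.mul_adjoint, h, tensorMat_one]
    exact h2

theorem NetMorphism.LocalizedIn.tensor {ρ σ : NetMorphism N} {c : DoubleCone}
    (hρ : ρ.LocalizedIn c) (hσ : σ.LocalizedIn c) : (ρ.tensor σ hσ.valued).LocalizedIn c := by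
  intro a ha A hA
  ext1 i j
  have h1 : σ.value hσ.valued A i.divNat j.divNat
      = A * σ.value hσ.valued 1 i.divNat j.divNat := by
    apply Subtype.ext
    change σ.hom A i.divNat j.divNat = A * σ.hom 1 i.divNat j.divNat
    rw [hσ a ha A hA, ampliation_mul_apply]
  refine Eq.trans ?_ (ampliation_mul_apply _ _ _ _).symm
  change ρ.hom (σ.value hσ.valued A i.divNat j.divNat) i.modNat j.modNat
    = A * ρ.hom (σ.value hσ.valued 1 i.divNat j.divNat) i.modNat j.modNat
  rw [h1, map_mul, hρ a ha A hA, Matrix.mul_assoc, ← map_mul, one_mul, ampliation_mul_apply]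

/-- The tensor product of objects. -/
def LTBimod.tensor (ρ σ : LTBimod N) : LTBimod N where
  toNetMorphism := ρ.toNetMorphism.tensor σ.toNetMorphism σ.valued
  localized := by
    obtain ⟨a, ha⟩ := ρ.localized
    obtain ⟨b, hb⟩ := σ.localized
    obtain ⟨c, hac, hbc⟩ := a.exists_upper b
    exact ⟨c, (ha.mono hac).tensor (hb.mono hbc)⟩
  transportable := by
    intro o
    obtain ⟨ρ', hρ', U, hU⟩ := ρ.transportable o
    obtain ⟨σ', hσ', V, hV⟩ := σ.transportable o
    refine ⟨ρ'.tensor σ' hσ'.valued, hρ'.tensor hσ', tensorMat ρ.toNetMorphism ρ' U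
      (Matrix.of fun i j => ⟨V i j, hV.toIsIntertwiner.mem_quasilocal σ.localized ⟨o, hσ'⟩ i j⟩),
      hU.tensor σ.valued hσ'.valued hV⟩

/-- The tensor product of arrows. -/
def LTBimod.tensorHom {ρ₁ ρ₂ σ₁ σ₂ : LTBimod N} (f : ρ₁ ⟶ ρ₂) (g : σ₁ ⟶ σ₂) :
    ρ₁.tensor σ₁ ⟶ ρ₂.tensor σ₂ :=
  ⟨tensorMat ρ₁.toNetMorphism ρ₂.toNetMorphism f.mat (LTBimod.Hom.value g),
    f.isIntertwiner.tensor σ₁.valued σ₂.valued g.isIntertwiner⟩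

theorem NetMorphism.ext_cast {ρ σ : NetMorphism N} (h : ρ.mult = σ.mult)
    (hom : ∀ A i j, ρ.hom A i j = σ.hom A (Fin.cast h i) (Fin.cast h j)) : ρ = σ := by
  obtain ⟨n, f⟩ := ρ
  obtain ⟨m, g⟩ := σ
  obtain rfl : n = m := h
  congr 1
  apply NonUnitalStarAlgHom.ext
  intro A
  ext1 i j
  exact hom A i j

/-- The tensor product of objects is strictly associative. -/
theorem LTBimod.tensor_assoc (ρ σ τ : LTBimod N) :
    (ρ.tensor σ).tensor τ = ρ.tensor (σ.tensor τ) := by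
  have h : ((ρ.tensor σ).tensor τ).toNetMorphism = (ρ.tensor (σ.tensor τ)).toNetMorphism := by
    refine NetMorphism.ext_cast (Nat.mul_assoc τ.mult σ.mult ρ.mult).symm fun A i j => ?_
    have e1 : ∀ i : Fin (τ.mult * (σ.mult * ρ.mult)), i.modNat.modNat
        = (Fin.cast (Nat.mul_assoc τ.mult σ.mult ρ.mult).symm i).modNat := by
      intro i
      apply Fin.ext
      simp [Fin.modNat]
    have e2 : ∀ i : Fin (τ.mult * (σ.mult * ρ.mult)), i.modNat.divNat
        = (Fin.cast (Nat.mul_assoc τ.mult σ.mult ρ.mult).symm i).divNat.modNat := by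
      intro i
      apply Fin.ext
      simp [Fin.modNat, Fin.divNat, Nat.mod_mul_left_div_self]
    have e3 : ∀ i : Fin (τ.mult * (σ.mult * ρ.mult)), i.divNat
        = (Fin.cast (Nat.mul_assoc τ.mult σ.mult ρ.mult).symm i).divNat.divNat := by
      intro i
      apply Fin.ext
      simp [Fin.divNat, Nat.div_div_eq_div_mul, Nat.mul_comm]
    have key : ∀ i j : Fin (τ.mult * (σ.mult * ρ.mult)),
        ρ.hom (σ.value σ.valued (τ.value τ.valued A i.divNat j.divNat) i.modNat.divNat
          j.modNat.divNat) i.modNat.modNat j.modNat.modNat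
        = (ρ.tensor (σ.tensor τ)).hom A
          (Fin.cast (Nat.mul_assoc τ.mult σ.mult ρ.mult).symm i)
          (Fin.cast (Nat.mul_assoc τ.mult σ.mult ρ.mult).symm j) := by
      intro i j
      rw [e1 i, e1 j, e2 i, e2 j, e3 i, e3 j]
      rfl
    exact key i j
  generalize (ρ.tensor σ).tensor τ = α at h
  generalize ρ.tensor (σ.tensor τ) = β at h
  cases α
  cases β
  cases h
  rfl

/-! ### Symmetries -/

open CategoryTheory in
/-- A symmetry of the category of localized transportable bimodules. As the tensor product is
strictly associative, the canonical isomorphisms between differently bracketed products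
are identities. -/
@[ext]
structure Symmetry (N : ReferenceNet H) where
  ε : ∀ ρ σ : LTBimod N, ρ.tensor σ ⟶ σ.tensor ρ
  naturality : ∀ {τ ρ β σ : LTBimod N} (T : τ ⟶ ρ) (S : β ⟶ σ),
    LTBimod.tensorHom T S ≫ ε ρ σ = ε τ β ≫ LTBimod.tensorHom S T
  adjoint : ∀ ρ σ : LTBimod N, LTBimod.adj (ε ρ σ) = ε σ ρ
  tensor : ∀ ρ τ σ : LTBimod N,
    ε ρ (τ.tensor σ) =
      eqToHom (LTBimod.tensor_assoc ρ τ σ).symm ≫ LTBimod.tensorHom (ε ρ τ) (𝟙 σ) ≫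
        eqToHom (LTBimod.tensor_assoc τ ρ σ) ≫ LTBimod.tensorHom (𝟙 τ) (ε ρ σ) ≫
          eqToHom (LTBimod.tensor_assoc τ σ ρ).symm
  symmetric : ∀ ρ σ : LTBimod N, ε σ ρ ≫ ε ρ σ = 𝟙 (σ.tensor ρ)

/-- The permutation matrix `θ(n, m)` with scalar entries, which exchanges the two factors of
a product of `n` and `m` dimensional index sets:
`θ(n, m) (A ⊗ B) = (B ⊗ A) θ(n, m)` for scalar matrices `A` and `B` of size `n` and `m`. -/
def theta (H : Type*) [NormedAddCommGroup H] [InnerProductSpace ℂ H] (n m : ℕ) :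
    Matrix (Fin (n * m)) (Fin (m * n)) (H →L[ℂ] H) :=
  Matrix.of fun i j => if i.divNat = j.modNat ∧ i.modNat = j.divNat then 1 else 0

/-- `θ(n_ρ, n_σ)`, with the shape of an operator from the space of `ρσ` to the space of `σρ`. -/
def LTBimod.theta (ρ σ : LTBimod N) :
    Matrix (Fin (σ.tensor ρ).mult) (Fin (ρ.tensor σ).mult) (H →L[ℂ] H) :=
  DHR.theta H ρ.mult σ.mult

/-- `ρ` and `σ` are localized in mutually spacelike double cones. -/
def SpacelikeLocalized (ρ σ : LTBimod N) : Prop :=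
  ∃ o a : DoubleCone, o.Perp a ∧ ρ.LocalizedIn o ∧ σ.LocalizedIn a

/-- An arrow is unitary. -/
def LTBimod.IsUnitary {ρ σ : LTBimod N} (U : ρ ⟶ σ) : Prop :=
  IsUnitaryIntertwiner ρ.toNetMorphism σ.toNetMorphism U.mat

end Net

end

end DHR

namespace DHR

noncomputable section

variable {H : Type*} [NormedAddCommGroup H] [InnerProductSpace ℂ H] [CompleteSpace H]
variable {N : ReferenceNet H}

/-! ### Geometry of spacelike separated double cones -/

/-! If `ρ` and `σ` are localized in spacelike separated double cones, then `ρ(σ(A))` and `σ(ρ(A))`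
agree entry by entry (`hom_hom_comm`), so `ρσ` and `σρ` differ only by the exchange of indices, and
`θ` cut down by `ρσ(1)` is an intertwiner. An arbitrary pair is carried to such a pair by unitaries
`U`, `V`, and naturality along `U × V` leaves `(V⁺ × U⁺) θ (U × V)` as the only possible value of
the symmetry. This gives uniqueness.

Existence rests on the independence of this expression from the choices. For two choices localized
in the same pair of spacelike cones, the unitaries between them have entries in the two local
algebras by Haag duality. These entries commute by locality, and each morphism acts trivially on the
other one's local algebra, so `θ` intertwines the product arrows (`theta_mul_tensorHom`,
`conjTheta_congr`). Consequently the value does not change when both cones are enlarged within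
spacelike separation. Any two pairs of spacelike cones are linked by such enlargements and their
inverses (`DoubleCone.Perp.connected`), which gives full independence (`braiding_mat`).

Connectedness also links a pair of cones with the same pair in the opposite order. This makes the
adjoint of `ε(ρ,σ)` equal to `ε(σ,ρ)` and hence gives a symmetry, not merely a braiding. The
remaining axioms are reduced by naturality to spacelike localized objects, where they are identities
between permuted entries of a projection. -/

theorem IsSpacelike.neg {x : Minkowski} (h : IsSpacelike x) : IsSpacelike (-x) := by
  simpa [IsSpacelike] using h

theorem DoubleCone.Perp.symm {a b : DoubleCone} (h : a.Perp b) : b.Perp a := by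
  intro x hx y hy
  simpa using (h y hy x hx).neg

theorem DoubleCone.Perp.mono_left {a b c : DoubleCone} (h : c.Perp b)
    (hac : a.carrier ⊆ c.carrier) : a.Perp b :=
  fun x hx y hy => h x (hac hx) y hy

theorem DoubleCone.Perp.mono {a b c d : DoubleCone} (h : c.Perp d)
    (hac : a.carrier ⊆ c.carrier) (hbd : b.carrier ⊆ d.carrier) : a.Perp b :=
  (h.mono_left hac).mono_right hbd

theorem forwardCone_add_closed {x y : Minkowski} (hx : x ∈ forwardCone) (hy : ‖y.2‖ ≤ y.1) :
    x + y ∈ forwardCone := by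
  simp only [forwardCone, Set.mem_ofPred_eq, Prod.fst_add, Prod.snd_add] at *
  exact lt_of_le_of_lt (norm_add_le _ _) (add_lt_add_of_lt_of_le hx hy)

theorem DoubleCone.carrier_subset {a b : DoubleCone}
    (hp : ‖(a.past - b.past).2‖ ≤ (a.past - b.past).1)
    (hf : ‖(b.future - a.future).2‖ ≤ (b.future - a.future).1) : a.carrier ⊆ b.carrier := by
  rintro x ⟨h1, h2⟩
  exact ⟨by simpa using forwardCone_add_closed h1 hp, by
    have := forwardCone_add_closed h2 hf
    rwa [add_comm, sub_add_sub_cancel] at this⟩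

theorem not_isSpacelike {x : Minkowski} (h : ¬ IsSpacelike x) :
    ‖x.2‖ ≤ x.1 ∨ ‖(-x).2‖ ≤ (-x).1 := by
  simp only [IsSpacelike, not_lt, sub_nonneg] at h
  have := sq_le_sq.1 h
  simp only [Prod.snd_neg, norm_neg, Prod.fst_neg]
  exact le_abs.1 ((abs_of_nonneg (norm_nonneg x.2)).symm.trans_le this)

/-- The tips do not belong to the open double cones, but the forward cone is open. Hence both tips
can be pushed slightly inwards, along the axes of their cones, without leaving the timelike
relation. -/
theorem DoubleCone.exists_mem_sub_mem_forwardCone {a b : DoubleCone}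
    (h : a.future - b.past ∈ forwardCone) :
    ∃ x ∈ a.carrier, ∃ y ∈ b.carrier, x - y ∈ forwardCone := by
  set v := a.future - b.past with hv
  set u := a.future - a.past with hu
  set w := b.future - b.past with hw
  have hu' := a.tips
  have hw' := b.tips
  rw [← hu] at hu'
  rw [← hw] at hw'
  have smul_mem : ∀ {t : ℝ} {x : Minkowski}, 0 < t → x ∈ forwardCone → t • x ∈ forwardCone := by
    intro t x ht hx
    simp only [forwardCone, Set.mem_ofPred_eq, Prod.smul_fst, Prod.smul_snd, norm_smul,
      smul_eq_mul, Real.norm_of_nonneg ht.le] at *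
    exact mul_lt_mul_of_pos_left hx ht
  obtain ⟨t, ht0, ht1, ht⟩ : ∃ t : ℝ, 0 < t ∧ t < 1 ∧ v - t • (u + w) ∈ forwardCone := by
    have hc : Filter.Tendsto (fun t : ℝ => ‖(v - t • (u + w)).2‖ - (v - t • (u + w)).1)
        (nhdsWithin 0 (Set.Ioi 0))
        (nhds (‖(v - (0 : ℝ) • (u + w)).2‖ - (v - (0 : ℝ) • (u + w)).1)) :=
      (Continuous.tendsto (by fun_prop) 0).mono_left nhdsWithin_le_nhds
    have h0 : ‖(v - (0 : ℝ) • (u + w)).2‖ - (v - (0 : ℝ) • (u + w)).1 < 0 := by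
      simpa [forwardCone] using h
    have h1 : ∀ᶠ t : ℝ in nhdsWithin 0 (Set.Ioi 0), t ∈ Set.Ioo (0 : ℝ) 1 :=
      Ioo_mem_nhdsGT one_pos
    obtain ⟨t, h2, h3⟩ := ((hc.eventually_lt_const h0).and h1).exists
    exact ⟨t, h3.1, h3.2, sub_neg.1 h2⟩
  refine ⟨a.future - t • u, ⟨?_, ?_⟩, b.past + t • w, ⟨?_, ?_⟩, ?_⟩
  · convert smul_mem (sub_pos.2 ht1) hu' using 1
    rw [hu]; module
  · convert smul_mem ht0 hu' using 1
    module
  · convert smul_mem ht0 hw' using 1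
    module
  · convert smul_mem (sub_pos.2 ht1) hw' using 1
    rw [hw]; module
  · convert ht using 1
    rw [hv]; module

theorem not_isSpacelike_of_mem_forwardCone {x : Minkowski} (h : x ∈ forwardCone) :
    ¬ IsSpacelike x := by
  simp only [forwardCone, Set.mem_ofPred_eq] at h
  simp only [IsSpacelike, not_lt, sub_nonneg]
  exact pow_le_pow_left₀ (norm_nonneg _) h.le 2

/-- Spacelike separation in terms of the tips. -/
theorem DoubleCone.perp_iff {a b : DoubleCone} :
    a.Perp b ↔ a.future - b.past ∉ forwardCone ∧ b.future - a.past ∉ forwardCone := by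
  refine ⟨fun h => ⟨fun h1 => ?_, fun h1 => ?_⟩, fun ⟨h1, h2⟩ x hx y hy => ?_⟩
  · obtain ⟨x, hx, y, hy, hxy⟩ := exists_mem_sub_mem_forwardCone h1
    exact not_isSpacelike_of_mem_forwardCone hxy (h x hx y hy)
  · obtain ⟨x, hx, y, hy, hxy⟩ := exists_mem_sub_mem_forwardCone h1
    exact not_isSpacelike_of_mem_forwardCone hxy (h.symm x hx y hy)
  -- If `x - y` is causal and future directed, it adds to `a.future - x` and `y - b.past` to give
  -- `a.future - b.past` in the forward cone. The other time orientation is symmetric.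
  · by_contra hxy
    obtain h | h := not_isSpacelike hxy
    · refine h1 ?_
      convert forwardCone_add_closed (forwardCone_add hx.2 hy.1) h using 1
      abel
    · refine h2 ?_
      convert forwardCone_add_closed (forwardCone_add hy.2 hx.1) h using 1
      abel

/-- The double cone over the ball of centre `x` and radius `r`. -/
def diamond (x : EuclideanSpace ℝ (Fin 3)) (r : ℝ) (hr : 0 < r) : DoubleCone where
  past := (-r, x)
  future := (r, x)
  tips := by simpa [forwardCone] using hr

theorem diamond_perp {x y : EuclideanSpace ℝ (Fin 3)} {r s : ℝ} {hr : 0 < r} {hs : 0 < s}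
    (h : r + s ≤ ‖x - y‖) : (diamond x r hr).Perp (diamond y s hs) := by
  rw [DoubleCone.perp_iff]
  simp only [diamond, forwardCone, Set.mem_ofPred_eq, Prod.fst_sub, Prod.snd_sub, not_lt,
    norm_sub_rev y x]
  constructor <;> linarith

theorem diamond_subset {x y : EuclideanSpace ℝ (Fin 3)} {r s : ℝ} {hr : 0 < r} {hs : 0 < s}
    (h : r + ‖x - y‖ ≤ s) : (diamond x r hr).carrier ⊆ (diamond y s hs).carrier := by
  apply DoubleCone.carrier_subset <;>
  simp only [diamond, Prod.fst_sub, Prod.snd_sub, norm_sub_rev y x] <;> linarith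

/-- The translate of a double cone by the spatial vector `v`. -/
def DoubleCone.translate (a : DoubleCone) (v : EuclideanSpace ℝ (Fin 3)) : DoubleCone where
  past := a.past + (0, v)
  future := a.future + (0, v)
  tips := by simpa using a.tips

/-- A bound for the tips of a double cone. -/
def DoubleCone.size (a : DoubleCone) : ℝ :=
  1 + (‖a.past.2‖ + |a.past.1|) + (‖a.future.2‖ + |a.future.1|)

theorem DoubleCone.size_pos (a : DoubleCone) : 0 < a.size := by
  unfold size; positivity

theorem DoubleCone.translate_subset_diamond (a : DoubleCone) (v : EuclideanSpace ℝ (Fin 3))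
    {r : ℝ} (hr : 0 < r) (h : a.size ≤ r) : (a.translate v).carrier ⊆ (diamond v r hr).carrier := by
  have h1 := norm_nonneg a.past.2
  have h2 := norm_nonneg a.future.2
  have h3 := neg_abs_le a.past.1
  have h4 := le_abs_self a.future.1
  have h5 := abs_nonneg a.past.1
  have h6 := abs_nonneg a.future.1
  unfold size at h
  apply carrier_subset
  · simp only [translate, diamond, Prod.fst_sub, Prod.snd_sub, Prod.fst_add, Prod.snd_add,
      add_sub_cancel_right]
    linarith
  · simp only [translate, diamond, Prod.fst_sub, Prod.snd_sub, Prod.fst_add, Prod.snd_add,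
      sub_add_cancel_right, norm_neg]
    linarith

theorem DoubleCone.subset_diamond (a : DoubleCone) {r : ℝ} (hr : 0 < r) (h : a.size ≤ r) :
    a.carrier ⊆ (diamond 0 r hr).carrier := by
  have := a.translate_subset_diamond 0 hr h
  have h0 : a.past + ((0, 0) : Minkowski) = a.past := add_zero _
  have h1 : a.future + ((0, 0) : Minkowski) = a.future := add_zero _
  simpa only [translate, h0, h1] using this

/-- A direction along which a vector outside the forward cone can be moved by a lightlike vector
without entering the forward cone. -/
theorem exists_light_direction {x : Minkowski} (hx : x ∉ forwardCone) :
    ∃ n : EuclideanSpace ℝ (Fin 3), ‖n‖ = 1 ∧ x.2 = ‖x.2‖ • n ∧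
      ∀ s : ℝ, 0 ≤ s → x + s • ((1, n) : Minkowski) ∉ forwardCone := by
  obtain ⟨n, hn, h⟩ : ∃ n : EuclideanSpace ℝ (Fin 3), ‖n‖ = 1 ∧ x.2 = ‖x.2‖ • n := by
    by_cases h0 : x.2 = 0
    · obtain ⟨n, hn⟩ := exists_norm_eq (EuclideanSpace ℝ (Fin 3)) zero_le_one
      exact ⟨n, hn, by simp [h0]⟩
    · exact ⟨‖x.2‖⁻¹ • x.2, norm_smul_inv_norm h0, by
        rw [smul_smul, mul_inv_cancel₀ (norm_ne_zero_iff.2 h0), one_smul]⟩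
  refine ⟨n, hn, h, fun s hs => ?_⟩
  simp only [forwardCone, Set.mem_ofPred_eq, Prod.fst_add, Prod.snd_add, Prod.smul_mk, not_lt,
    smul_eq_mul, mul_one] at *
  -- As `n` points along the spatial part of `x`, the triangle inequality is an equality: time and
  -- spatial length grow at the same rate.
  have : ‖x.2 + s • n‖ = ‖x.2‖ + s := by
    rw [h, ← add_smul, norm_smul, hn, norm_smul, hn, Real.norm_of_nonneg (by positivity)]
    simp
  linarith

/-- Equal directions would make the spatial parts parallel, so their lengths would add. Then `x + y`
would stay outside the forward cone along with `x` and `y`. Distinctness is needed because `n - m`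
will be the direction of escape. -/
theorem exists_light_directions {x y : Minkowski} (hx : x ∉ forwardCone) (hy : y ∉ forwardCone)
    (hxy : x + y ∈ forwardCone) :
    ∃ n m : EuclideanSpace ℝ (Fin 3), ‖n‖ = 1 ∧ ‖m‖ = 1 ∧ n ≠ m ∧
      (∀ s : ℝ, 0 ≤ s → x + s • ((1, n) : Minkowski) ∉ forwardCone) ∧
      (∀ s : ℝ, 0 ≤ s → y + s • ((1, m) : Minkowski) ∉ forwardCone) := by
  obtain ⟨n, hn, hxn, hns⟩ := exists_light_direction hx
  obtain ⟨m, hm, hym, hms⟩ := exists_light_direction hy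
  refine ⟨n, m, hn, hm, ?_, hns, hms⟩
  rintro rfl
  simp only [forwardCone, Set.mem_ofPred_eq, Prod.fst_add, Prod.snd_add, not_lt] at *
  rw [hxn, hym, ← add_smul, norm_smul, hn, Real.norm_of_nonneg (by positivity)] at hxy
  linarith

/-- A double cone which is spacelike to `b` can be moved to infinity in the spacelike
complement of `b`. -/
theorem DoubleCone.Perp.exists_translate {a b : DoubleCone} (h : a.Perp b) :
    ∃ d : EuclideanSpace ℝ (Fin 3), d ≠ 0 ∧ ∀ s : ℝ, 0 ≤ s → ∃ c : DoubleCone,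
      a.carrier ⊆ c.carrier ∧ (a.translate (s • d)).carrier ⊆ c.carrier ∧ c.Perp b := by
  obtain ⟨h1, h2⟩ := DoubleCone.perp_iff.1 h
  obtain ⟨n, m, hn, hm, hnm, hns, hms⟩ := exists_light_directions h1 h2 (by
    convert forwardCone_add a.tips b.tips using 1
    abel)
  -- The enlarged cone has its future tip moved by `s(1, n)` and its past tip by `-s(1, m)`, so it
  -- remains spacelike to `b`. Relative to the translate by `s(n - m)/2`, both tips recede by `s(1,
  -- (n + m)/2)`, which is causal since `‖(n + m)/2‖ ≤ 1`.
  refine ⟨(2⁻¹ : ℝ) • (n - m), smul_ne_zero (by norm_num) (sub_ne_zero.2 hnm), fun s hs => ?_⟩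
  have h3 : ‖(2⁻¹ : ℝ) • (n + m)‖ ≤ 1 := by
    rw [norm_smul, Real.norm_of_nonneg (by norm_num)]
    have := norm_add_le n m
    linarith
  refine ⟨⟨a.past - s • ((1, m) : Minkowski), a.future + s • ((1, n) : Minkowski), ?_⟩,
    ?_, ?_, ?_⟩
  · have h4 : ‖(s • ((2, n + m) : Minkowski)).2‖ ≤ (s • ((2, n + m) : Minkowski)).1 := by
      simp only [Prod.smul_mk, norm_smul, Real.norm_of_nonneg hs, smul_eq_mul]
      refine mul_le_mul_of_nonneg_left ?_ hs
      have := norm_add_le n m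
      linarith
    convert forwardCone_add_closed a.tips h4 using 1
    ext1 <;> simp <;> first | ring | module
  · apply DoubleCone.carrier_subset <;>
    simp [norm_smul, hn, hm, abs_of_nonneg hs]
  · have h4 : ‖s • (2⁻¹ : ℝ) • (n + m)‖ ≤ s := by
      rw [norm_smul, Real.norm_of_nonneg hs]
      exact mul_le_of_le_one_right hs h3
    apply DoubleCone.carrier_subset
    · simp only [translate, Prod.fst_sub, Prod.snd_sub, Prod.fst_add, Prod.snd_add, Prod.smul_mk]
      convert h4 using 1
      · congr 1; module
      · simp
    · simp only [translate, Prod.fst_sub, Prod.snd_sub, Prod.fst_add, Prod.snd_add, Prod.smul_mk]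
      convert h4 using 1
      · congr 1; module
      · simp
  · rw [DoubleCone.perp_iff]
    constructor
    · convert hns s hs using 2
      simp only; abel
    · convert hms s hs using 2
      simp only; abel

theorem DoubleCone.exists_perp (c : DoubleCone) : ∃ o : DoubleCone, o.Perp c := by
  obtain ⟨x, hx⟩ := exists_norm_eq (EuclideanSpace ℝ (Fin 3)) (c := 1 + c.size)
    (by have := c.size_pos; linarith)
  exact ⟨diamond x 1 one_pos, (diamond_perp (hs := c.size_pos) (by simpa using hx.ge)).mono_right
    (c.subset_diamond c.size_pos le_rfl)⟩

/-- A double cone `a` which is spacelike to `b` can be moved, in the spacelike complement of `b`,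
to a double cone which is spacelike to any given double cone `c`. -/
theorem DoubleCone.Perp.exists_move {a b : DoubleCone} (h : a.Perp b) (c : DoubleCone) :
    ∃ a' e : DoubleCone, a'.Perp c ∧ a.carrier ⊆ e.carrier ∧ a'.carrier ⊆ e.carrier ∧
      e.Perp b := by
  obtain ⟨d, hd, H⟩ := h.exists_translate
  have ha := a.size_pos
  have hc := c.size_pos
  -- The displacement has length `a.size + c.size`, just enough to separate the diamonds of these
  -- radii that contain the translate of `a` and `c`.
  obtain ⟨e, h1, h2, h3⟩ := H ((a.size + c.size) / ‖d‖) (by positivity)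
  refine ⟨_, e, ?_, h1, h2, h3⟩
  refine (diamond_perp ?_).mono (a.translate_subset_diamond _ ha le_rfl)
    (c.subset_diamond hc le_rfl)
  rw [sub_zero, norm_smul, Real.norm_of_nonneg (by positivity),
    div_mul_cancel₀ _ (norm_ne_zero_iff.2 hd)]

open scoped RealInnerProductSpace in
/-- Functions of pairs of spacelike separated double cones which do not change if the double
cones are enlarged are constant. -/
theorem DoubleCone.Perp.connected {X : Type*} (E : DoubleCone → DoubleCone → X)
    (hE : ∀ o a c d : DoubleCone, o.carrier ⊆ c.carrier → a.carrier ⊆ d.carrier → c.Perp d →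
      E o a = E c d)
    {o a o' a' : DoubleCone} (h : o.Perp a) (h' : o'.Perp a') : E o a = E o' a' := by
  set r := o.size + a.size + o'.size + a'.size with hr
  have p1 := o.size_pos
  have p2 := a.size_pos
  have p3 := o'.size_pos
  have p4 := a'.size_pos
  have hr0 : 0 < r := by positivity
  -- Normal form of a pair: the first cone slides away while the second stays fixed. Once they are
  -- `4r` apart, both can be enlarged to diamonds of the common radius `r`.
  have far : ∀ {b c : DoubleCone}, b.Perp c → b.size ≤ r → c.size ≤ r →
      ∃ x : EuclideanSpace ℝ (Fin 3), ‖x‖ = 4 * r ∧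
        E b c = E (diamond x r hr0) (diamond 0 r hr0) := by
    intro b c hbc hb hc
    obtain ⟨d, hd, H⟩ := hbc.exists_translate
    obtain ⟨e, h1, h2, h3⟩ := H (4 * r / ‖d‖) (by positivity)
    have hx : ‖(4 * r / ‖d‖) • d‖ = 4 * r := by
      rw [norm_smul, Real.norm_of_nonneg (by positivity),
        div_mul_cancel₀ _ (norm_ne_zero_iff.2 hd)]
    refine ⟨_, hx, ?_⟩
    rw [hE b c e c h1 subset_rfl h3, ← hE _ c e c h2 subset_rfl h3]
    refine hE _ _ _ _ (b.translate_subset_diamond _ hr0 hb) (c.subset_diamond hr0 hc)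
      (diamond_perp ?_)
    rw [sub_zero, hx]
    linarith
  -- Both diamonds lie in the one of radius `3r = 2r + r` about the midpoint `u + v/2`. By
  -- Pythagoras this midpoint is at distance `√20 r ≥ 3r + r` from the origin, so the large diamond
  -- is still spacelike to the one at `0`.
  have turn : ∀ u v : EuclideanSpace ℝ (Fin 3), ‖u‖ = 4 * r → ‖v‖ = 4 * r → ⟪u, v⟫ = 0 →
      E (diamond u r hr0) (diamond 0 r hr0) = E (diamond (u + v) r hr0) (diamond 0 r hr0) := by
    intro u v hu hv huv
    have q : 0 < 3 * r := by positivity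
    have hperp : (diamond (u + (2⁻¹ : ℝ) • v) (3 * r) q).Perp (diamond 0 r hr0) := by
      apply diamond_perp
      have h1 : ‖u + (2⁻¹ : ℝ) • v‖ ^ 2 = (4 * r) ^ 2 + (2 * r) ^ 2 := by
        rw [norm_add_sq_real, inner_smul_right, huv, norm_smul, hu, hv,
          Real.norm_of_nonneg (by norm_num)]
        ring
      rw [sub_zero]
      refine le_of_sq_le_sq ?_ (norm_nonneg _)
      rw [h1]
      nlinarith
    have e1 : ‖(2⁻¹ : ℝ) • v‖ = 2 * r := by
      rw [norm_smul, hv, Real.norm_of_nonneg (by norm_num)]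
      ring
    rw [hE _ _ _ _ (diamond_subset (hs := q) (y := u + (2⁻¹ : ℝ) • v) ?_) subset_rfl hperp,
      hE (diamond (u + v) r hr0) _ _ _ (diamond_subset (hs := q) (y := u + (2⁻¹ : ℝ) • v) ?_)
        subset_rfl hperp]
    · have : u + v - (u + (2⁻¹ : ℝ) • v) = (2⁻¹ : ℝ) • v := by module
      rw [this, e1]
      linarith
    · rw [sub_add_cancel_left, norm_neg, e1]
      linarith
  obtain ⟨x, hx, hEx⟩ := far h (by linarith) (by linarith)
  obtain ⟨y, hy, hEy⟩ := far h' (by linarith) (by linarith)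
  -- Two vectors span at most a plane, and space has dimension three. A common normal makes
  -- right-angled turns possible from both `x` and `y`.
  obtain ⟨w, hw, hxw, hyw⟩ : ∃ w : EuclideanSpace ℝ (Fin 3), ‖w‖ = 4 * r ∧ ⟪x, w⟫ = 0 ∧
      ⟪y, w⟫ = 0 := by
    have hlt : Submodule.span ℝ {x, y} < ⊤ := by
      classical
      have := finrank_span_finset_le_card (R := ℝ) {x, y}
      rw [Finset.coe_pair] at this
      refine Submodule.lt_top_of_finrank_lt_finrank (this.trans_lt ?_)
      rw [finrank_euclideanSpace_fin]
      exact Finset.card_le_two.trans_lt (by norm_num)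
    have hne : (Submodule.span ℝ {x, y})ᗮ ≠ ⊥ := by
      rw [Ne, Submodule.orthogonal_eq_bot_iff]
      exact hlt.ne
    obtain ⟨z, hz, hz0⟩ := Submodule.exists_mem_ne_zero_of_ne_bot hne
    rw [Submodule.mem_orthogonal] at hz
    refine ⟨(4 * r / ‖z‖) • z, ?_, ?_, ?_⟩
    · rw [norm_smul, Real.norm_of_nonneg (by positivity),
        div_mul_cancel₀ _ (norm_ne_zero_iff.2 hz0)]
    · rw [inner_smul_right, hz x (Submodule.subset_span (by simp)), mul_zero]
    · rw [inner_smul_right, hz y (Submodule.subset_span (by simp)), mul_zero]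
  -- The path of centres is `x`, `x + w`, `w`, `y + w`, `y`.
  rw [hEx, hEy, turn x w hx hw hxw, turn y w hy hw hyw, add_comm x, add_comm y,
    ← turn w x hw hx (by rwa [real_inner_comm]), ← turn w y hw hy (by rwa [real_inner_comm])]

/-! ### The permutation matrices -/

/-- The exchange of the two components of a product index. -/
def pairSwap (n m : ℕ) (i : Fin (n * m)) : Fin (m * n) :=
  finProdFinEquiv (i.modNat, i.divNat)

@[simp]
theorem pairSwap_divNat {n m : ℕ} (i : Fin (n * m)) : (pairSwap n m i).divNat = i.modNat :=
  congrArg Prod.fst (finProdFinEquiv.symm_apply_apply (i.modNat, i.divNat))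

@[simp]
theorem pairSwap_modNat {n m : ℕ} (i : Fin (n * m)) : (pairSwap n m i).modNat = i.divNat :=
  congrArg Prod.snd (finProdFinEquiv.symm_apply_apply (i.modNat, i.divNat))

theorem ext_divNat_modNat {n m : ℕ} {i j : Fin (n * m)} (h₁ : i.divNat = j.divNat)
    (h₂ : i.modNat = j.modNat) : i = j :=
  finProdFinEquiv.symm.injective (Prod.ext h₁ h₂)

theorem eq_pairSwap_iff {n m : ℕ} {i : Fin (n * m)} {j : Fin (m * n)} :
    j = pairSwap n m i ↔ i.divNat = j.modNat ∧ i.modNat = j.divNat := by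
  refine ⟨?_, fun h => ext_divNat_modNat ?_ ?_⟩
  · rintro rfl
    simp
  · simp [h.2]
  · simp [h.1]

/-- Each row of `θ` has a single entry `1`, so products with `θ` are reindexings and identities
involving it can be checked entry by entry. -/
theorem theta_mul {K : Type*} [NormedAddCommGroup K] [InnerProductSpace ℂ K]
    {n m : ℕ} {κ : Type*} (M : Matrix (Fin (m * n)) κ (K →L[ℂ] K)) :
    theta K n m * M = M.submatrix (pairSwap n m) id := by
  ext1 i j
  simp [Matrix.mul_apply, theta, ← eq_pairSwap_iff]

theorem mul_theta {K : Type*} [NormedAddCommGroup K] [InnerProductSpace ℂ K]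
    {n m : ℕ} {κ : Type*} (M : Matrix κ (Fin (n * m)) (K →L[ℂ] K)) :
    M * theta K n m = M.submatrix id (pairSwap m n) := by
  ext1 i j
  have h : ∀ k : Fin (n * m), (k.divNat = j.modNat ∧ k.modNat = j.divNat) ↔
      k = pairSwap m n j := fun k => by
    rw [eq_pairSwap_iff]
    constructor <;> rintro ⟨h1, h2⟩ <;> exact ⟨h2.symm, h1.symm⟩
  simp [Matrix.mul_apply, theta, h]

theorem theta_conjTranspose (n m : ℕ) : (theta H n m).conjTranspose = theta H m n := by
  ext1 i j
  simp only [theta, Matrix.conjTranspose_apply, Matrix.of_apply, apply_ite star, star_one,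
    star_zero]
  refine if_congr ?_ rfl rfl
  constructor <;> rintro ⟨h1, h2⟩ <;> exact ⟨h2.symm, h1.symm⟩

theorem theta_mul_theta {K : Type*} [NormedAddCommGroup K] [InnerProductSpace ℂ K]
    {n m : ℕ} {κ : Type*} (M : Matrix (Fin (m * n)) κ (K →L[ℂ] K)) :
    theta K m n * (theta K n m * M) = M := by
  rw [theta_mul, theta_mul]
  ext1 i j
  simp only [Matrix.submatrix_apply, id]
  congr 1
  exact ext_divNat_modNat (by simp) (by simp)

/-! ### Morphisms and intertwiners in spacelike separated regions -/

/-- On the algebra of a cone spacelike to its localization, `ρ₁` is `A ↦ ρ₁(1)(A ⊗ 1)`, and `T`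
absorbs `ρ₁(1)`. The sum in the product of arrows therefore collapses to one term. -/
theorem tensorMat_apply_of_perp {ρ₁ ρ₂ : NetMorphism N} {m n : ℕ}
    {T : Matrix (Fin ρ₂.mult) (Fin ρ₁.mult) (H →L[ℂ] H)} (hT : T * ρ₁.hom 1 = T)
    {S : Matrix (Fin m) (Fin n) N.quasilocal} {c d : DoubleCone} (hcd : c.Perp d)
    (hρ₁ : ρ₁.LocalizedIn c) (hS : ∀ i j, (S i j : H →L[ℂ] H) ∈ N.alg d)
    (i : Fin (m * ρ₂.mult)) (j : Fin (n * ρ₁.mult)) :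
    tensorMat ρ₁ ρ₂ T S i j = T i.modNat j.modNat * (S i.divNat j.divNat : H →L[ℂ] H) := by
  rw [tensorMat_apply, hρ₁.eq_mul_ampliation hcd.symm _ (hS _ _), ← Matrix.mul_assoc, hT,
    mul_ampliation_apply]

/-- By Haag duality the entries of `f` lie in the algebra of `c` and those of `g` in that of `d`.
Both products of arrows then have plain products of entries, which commute by locality. -/
theorem LTBimod.theta_mul_tensorHom {ρ₁ ρ₂ σ₁ σ₂ : LTBimod N} (f : ρ₁ ⟶ ρ₂) (g : σ₁ ⟶ σ₂)
    {c d : DoubleCone} (hcd : c.Perp d) (hρ₁ : ρ₁.LocalizedIn c) (hρ₂ : ρ₂.LocalizedIn c)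
    (hσ₁ : σ₁.LocalizedIn d) (hσ₂ : σ₂.LocalizedIn d) :
    LTBimod.theta ρ₂ σ₂ * (LTBimod.tensorHom f g).mat
      = (LTBimod.tensorHom g f).mat * LTBimod.theta ρ₁ σ₁ := by
  have hf := f.isIntertwiner.mem_alg hρ₁ hρ₂
  have hg := g.isIntertwiner.mem_alg hσ₁ hσ₂
  refine (theta_mul _).trans (Eq.trans ?_ (mul_theta _).symm)
  refine Matrix.ext fun (i : Fin (ρ₂.mult * σ₂.mult)) (j : Fin (σ₁.mult * ρ₁.mult)) => ?_
  refine (tensorMat_apply_of_perp f.isIntertwiner.mul_one hcd hρ₁ hg (pairSwap _ _ i) j).trans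
    (Eq.trans ?_ (tensorMat_apply_of_perp g.isIntertwiner.mul_one hcd.symm hσ₁ hf i
      (pairSwap _ _ j)).symm)
  simp only [pairSwap_divNat, pairSwap_modNat]
  exact (N.locality c d hcd (hf _ _) _ (hg _ _)).symm

/-- Double cones are directed under inclusion, so the union of the local algebras is already a
*-algebra. -/
theorem LocalNet.exists_mem_alg_of_mem_adjoin (N : LocalNet H) {A : H →L[ℂ] H}
    (hA : A ∈ StarAlgebra.adjoin ℂ
      {A : H →L[ℂ] H | ∃ a : DoubleCone, a.carrier ⊆ Set.univ ∧ A ∈ N.alg a}) :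
    ∃ a : DoubleCone, A ∈ N.alg a := by
  induction hA using StarAlgebra.adjoin_induction with
  | mem x hx =>
    obtain ⟨a, -, ha⟩ := hx
    exact ⟨a, ha⟩
  | algebraMap r => exact ⟨diamond 0 1 one_pos, (N.alg _).algebraMap_mem' r⟩
  | add x y _ _ hx hy =>
    obtain ⟨a, ha⟩ := hx
    obtain ⟨b, hb⟩ := hy
    obtain ⟨c, hac, hbc⟩ := a.exists_upper b
    exact ⟨c, add_mem (N.isotony a c hac ha) (N.isotony b c hbc hb)⟩
  | mul x y _ _ hx hy =>
    obtain ⟨a, ha⟩ := hx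
    obtain ⟨b, hb⟩ := hy
    obtain ⟨c, hac, hbc⟩ := a.exists_upper b
    exact ⟨c, mul_mem (N.isotony a c hac ha) (N.isotony b c hbc hb)⟩
  | star x _ hx =>
    obtain ⟨a, ha⟩ := hx
    exact ⟨a, star_mem ha⟩

/-- Continuous functions on the quasilocal algebra which agree on the local algebras agree. -/
theorem LocalNet.eq_of_eqOn_alg (N : LocalNet H) {X : Type*} [TopologicalSpace X] [T2Space X]
    {f g : N.quasilocal → X} (hf : Continuous f) (hg : Continuous g)
    (h : ∀ (a : DoubleCone) (A : N.quasilocal), (A : H →L[ℂ] H) ∈ N.alg a → f A = g A) :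
    f = g := by
  funext ⟨A, hA⟩
  obtain ⟨u, hu, hlim⟩ := mem_closure_iff_seq_limit.1 hA
  choose a ha using fun n => N.exists_mem_alg_of_mem_adjoin (hu n)
  have hlim' : Filter.Tendsto
      (fun n => (⟨u n, N.alg_le_quasilocal _ (ha n)⟩ : N.quasilocal)) Filter.atTop
      (nhds ⟨A, hA⟩) := tendsto_subtype_rng.2 hlim
  refine tendsto_nhds_unique ((hf.tendsto _).comp hlim') ?_
  refine ((hg.tendsto _).comp hlim').congr fun n => ?_
  exact (h _ _ (ha n)).symm

/-- A morphism which is unitarily equivalent to one localized in `o` is implemented, on the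
algebras of the double cones spacelike to `o`, by the unitary. -/
theorem IsUnitaryIntertwiner.hom_eq {ρ σ : NetMorphism N}
    {U : Matrix (Fin σ.mult) (Fin ρ.mult) (H →L[ℂ] H)} (hU : IsUnitaryIntertwiner ρ σ U)
    {o a : DoubleCone} (ho : σ.LocalizedIn o) (hoa : o.Perp a) (A : N.quasilocal)
    (hA : (A : H →L[ℂ] H) ∈ N.alg a) :
    ρ.hom A = U.conjTranspose * (ampliation σ.mult (A : H →L[ℂ] H) * U) := by
  rw [← one_mul A, map_mul, ← hU.adjoint_mul, Matrix.mul_assoc, hU.intertwines,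
    ho a hoa.symm A hA, Matrix.mul_assoc, hU.one_mul, one_mul]

/-- On a local algebra, `ρ` is implemented by a unitary `U` to a copy of `ρ` localized far away,
chosen with entries on which `σ` acts trivially. Both `ρ(σ(A))` and `σ(ρ(A))` then become `U⁺ σ(A)
U`. -/
theorem NetMorphism.LocalizedIn.hom_hom_comm_of_mem {ρ σ : NetMorphism N} {o a : DoubleCone}
    (hρ : ρ.LocalizedIn o) (hσ : σ.LocalizedIn a) (hoa : o.Perp a) (htr : ρ.Transportable)
    {b : DoubleCone} (A : N.quasilocal) (hA : (A : H →L[ℂ] H) ∈ N.alg b)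
    (i j : Fin ρ.mult) (k l : Fin σ.mult) :
    ρ.hom (σ.value hσ.valued A k l) i j = σ.hom (ρ.value hρ.valued A i j) k l := by
  obtain ⟨c, hbc, hac⟩ := b.exists_upper a
  -- Two requirements meet here: `o'` is spacelike to `c`, which contains `a` and the localization
  -- of `A`, whereas `e`, which contains `o` and `o'` and hence carries the entries of `U`, need
  -- only be spacelike to `a`.
  obtain ⟨o', e, ho'c, hoe, ho'e, hea⟩ := hoa.exists_move c
  obtain ⟨ρ', hρ', U, hU⟩ := htr o'
  have hmem := hU.toIsIntertwiner.mem_alg (hρ.mono hoe) (hρ'.mono ho'e)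
  have hAc := N.isotony b c hbc hA
  let u : Fin ρ'.mult → Fin ρ.mult → N.quasilocal := fun p q =>
    ⟨U p q, N.alg_le_quasilocal e (hmem p q)⟩
  have hval : ρ.value hρ.valued A i j = ∑ p, star (u p i) * (A * u p j) := by
    apply Subtype.ext
    refine (congrFun (congrFun (hU.hom_eq hρ' ho'c A hAc) i) j).trans ?_
    rw [Matrix.mul_apply]
    simp only [ampliation_mul_apply, AddSubmonoidClass.coe_finsetSum, MulMemClass.coe_mul,
      StarMemClass.coe_star, u]
    rfl
  have hleft : ∀ (p : Fin ρ'.mult) (q : Fin ρ.mult)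
      (M : Matrix (Fin σ.mult) (Fin σ.mult) (H →L[ℂ] H)), σ.hom 1 * M = M →
        σ.hom (star (u p q)) * M = ampliation σ.mult (star (U p q)) * M := by
    intro p q M hM
    rw [hσ e hea _ (star_mem (hmem p q)), Matrix.mul_assoc, hM]
    rfl
  have hone : ∀ B, σ.hom 1 * σ.hom B = σ.hom B := fun B => by rw [← map_mul, one_mul]
  have hright : ∀ (p : Fin ρ'.mult) (q : Fin ρ.mult),
      σ.hom (A * u p q) = σ.hom A * ampliation σ.mult (U p q) := by
    intro p q
    rw [map_mul, hσ.eq_mul_ampliation hea (u p q) (hmem p q), ← Matrix.mul_assoc, ← map_mul,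
      mul_one]
  rw [hval, map_sum, Matrix.sum_apply]
  -- As `c` contains `a`, `σ` maps the algebra of `c` into matrices over it, so `U` implements `ρ`
  -- on the entries of `σ(A)` too.
  have hσA : (σ.value hσ.valued A k l : H →L[ℂ] H) ∈ N.alg c :=
    (hσ.mono hac).hom_mem_alg A hAc k l
  rw [hU.hom_eq hρ' ho'c _ hσA, Matrix.mul_apply]
  refine Finset.sum_congr rfl fun p _ => ?_
  rw [ampliation_mul_apply, map_mul, hleft _ _ _ (hone _), ampliation_mul_apply, hright,
    mul_ampliation_apply]
  rfl

/-- Morphisms localized in spacelike separated double cones commute. -/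
theorem NetMorphism.LocalizedIn.hom_hom_comm {ρ σ : NetMorphism N} {o a : DoubleCone}
    (hρ : ρ.LocalizedIn o) (hσ : σ.LocalizedIn a) (hoa : o.Perp a) (htr : ρ.Transportable)
    (A : N.quasilocal) (i j : Fin ρ.mult) (k l : Fin σ.mult) :
    ρ.hom (σ.value hσ.valued A k l) i j = σ.hom (ρ.value hρ.valued A i j) k l := by
  refine congrFun (N.eq_of_eqOn_alg
    (f := fun A => ρ.hom (σ.value hσ.valued A k l) i j)
    (g := fun A => σ.hom (ρ.value hρ.valued A i j) k l) ?_ ?_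
    fun b A hA => hρ.hom_hom_comm_of_mem hσ hoa htr A hA i j k l) A
  · exact (ρ.continuous_entry i j).comp ((σ.continuous_entry k l).subtype_mk _)
  · exact (σ.continuous_entry k l).comp ((ρ.continuous_entry i j).subtype_mk _)

theorem SpacelikeLocalized.hom_hom_comm {ρ σ : LTBimod N} (h : SpacelikeLocalized ρ σ)
    (A : N.quasilocal) (i j : Fin ρ.mult) (k l : Fin σ.mult) :
    ρ.hom (σ.value σ.valued A k l) i j = σ.hom (ρ.value ρ.valued A i j) k l := by
  obtain ⟨o, a, hoa, hρ, hσ⟩ := h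
  exact hρ.hom_hom_comm hσ hoa ρ.transportable A i j k l

theorem SpacelikeLocalized.theta_mul_hom {ρ σ : LTBimod N} (h : SpacelikeLocalized ρ σ)
    (A : N.quasilocal) :
    LTBimod.theta ρ σ * (ρ.tensor σ).hom A = (σ.tensor ρ).hom A * LTBimod.theta ρ σ := by
  refine (theta_mul _).trans (Eq.trans ?_ (mul_theta _).symm)
  have key : ∀ (i : Fin (ρ.mult * σ.mult)) (j : Fin (σ.mult * ρ.mult)),
      ρ.hom (σ.value σ.valued A (pairSwap _ _ i).divNat j.divNat) (pairSwap _ _ i).modNat j.modNat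
        = σ.hom (ρ.value ρ.valued A i.divNat (pairSwap _ _ j).divNat) i.modNat
          (pairSwap _ _ j).modNat := by
    intro i j
    rw [h.hom_hom_comm]
    simp only [pairSwap_divNat, pairSwap_modNat]
  exact Matrix.ext key

/-- Morphisms need not be unital, so an intertwiner must absorb the projections at both ends. The
factor `ρσ(1)` ensures this on the right, and moving it through `θ` ensures it on the left. -/
theorem SpacelikeLocalized.isIntertwiner {ρ σ : LTBimod N} (h : SpacelikeLocalized ρ σ) :
    IsIntertwiner (ρ.tensor σ).toNetMorphism (σ.tensor ρ).toNetMorphism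
      (LTBimod.theta ρ σ * (ρ.tensor σ).hom 1) where
  mul_one := by rw [Matrix.mul_assoc, ← map_mul, _root_.mul_one]
  one_mul := by
    rw [← Matrix.mul_assoc, ← h.theta_mul_hom, Matrix.mul_assoc, ← map_mul, _root_.mul_one]
  intertwines A := by
    rw [Matrix.mul_assoc, ← Matrix.mul_assoc _ (LTBimod.theta ρ σ), ← h.theta_mul_hom,
      Matrix.mul_assoc, ← map_mul, ← map_mul, _root_.mul_one, _root_.one_mul]

/-- The exchange of the factors of a product of objects which are localized in spacelike
separated double cones. -/
def SpacelikeLocalized.exchange {ρ σ : LTBimod N} (h : SpacelikeLocalized ρ σ) :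
    ρ.tensor σ ⟶ σ.tensor ρ :=
  ⟨LTBimod.theta ρ σ * (ρ.tensor σ).hom 1, h.isIntertwiner⟩

open CategoryTheory

/-! ### The tensor product is functorial and strictly associative on arrows -/

namespace LTBimod

@[simp]
theorem comp_mat {ρ σ τ : LTBimod N} (f : ρ ⟶ σ) (g : σ ⟶ τ) : (f ≫ g).mat = g.mat * f.mat :=
  rfl

@[simp]
theorem id_mat (ρ : LTBimod N) : (𝟙 ρ : ρ ⟶ ρ).mat = ρ.hom 1 :=
  rfl

theorem hom_ext {ρ σ : LTBimod N} {f g : ρ ⟶ σ} (h : f.mat = g.mat) : f = g :=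
  Hom.ext h

theorem value_comp {ρ σ τ : LTBimod N} (f : ρ ⟶ σ) (g : σ ⟶ τ) :
    Hom.value (f ≫ g) = Hom.value g * Hom.value f := by
  ext1 i j
  apply Subtype.ext
  change (g.mat * f.mat) i j = _
  simp only [Matrix.mul_apply, AddSubmonoidClass.coe_finsetSum, MulMemClass.coe_mul]
  rfl

theorem tensorHom_comp {ρ₁ ρ₂ ρ₃ σ₁ σ₂ σ₃ : LTBimod N} (f : ρ₁ ⟶ ρ₂) (f' : ρ₂ ⟶ ρ₃)
    (g : σ₁ ⟶ σ₂) (g' : σ₂ ⟶ σ₃) :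
    tensorHom (f ≫ f') (g ≫ g') = tensorHom f g ≫ tensorHom f' g' := by
  apply hom_ext
  refine Eq.trans ?_ (tensorMat_mul f.isIntertwiner f'.mat (Hom.value g') (Hom.value g)).symm
  rw [← value_comp]
  rfl

theorem tensorHom_id (ρ σ : LTBimod N) : tensorHom (𝟙 ρ) (𝟙 σ) = 𝟙 (ρ.tensor σ) :=
  hom_ext (tensorMat_one ρ.toNetMorphism (Hom.value (𝟙 σ)))

theorem adj_comp {ρ σ τ : LTBimod N} (f : ρ ⟶ σ) (g : σ ⟶ τ) : adj (f ≫ g) = adj g ≫ adj f :=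
  hom_ext (Matrix.conjTranspose_mul _ _)

theorem adj_adj {ρ σ : LTBimod N} (f : ρ ⟶ σ) : adj (adj f) = f :=
  hom_ext (Matrix.conjTranspose_conjTranspose _)

theorem adj_tensorHom {ρ₁ ρ₂ σ₁ σ₂ : LTBimod N} (f : ρ₁ ⟶ ρ₂) (g : σ₁ ⟶ σ₂) :
    adj (tensorHom f g) = tensorHom (adj f) (adj g) :=
  hom_ext (tensorMat_conjTranspose f.isIntertwiner (Hom.value g))

/-- Identifications of objects act on matrices only by relabelling indices. This form allows
rebracketing to be computed by index arithmetic. -/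
theorem comp_eqToHom_mat {ρ σ τ : LTBimod N} (f : ρ ⟶ σ) (h : σ = τ) :
    (f ≫ eqToHom h).mat = f.mat.submatrix (Fin.cast (congrArg (fun α => α.mult) h.symm)) id := by
  subst h
  rw [eqToHom_refl, Category.comp_id]
  rfl

theorem eqToHom_comp_mat {ρ σ τ : LTBimod N} (h : ρ = σ) (f : σ ⟶ τ) :
    (eqToHom h ≫ f).mat = f.mat.submatrix id (Fin.cast (congrArg (fun α => α.mult) h)) := by
  subst h
  rw [eqToHom_refl, Category.id_comp]
  rfl

end LTBimod

/-- The change of bracketing of a product index. -/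
def assocIndex (n m l : ℕ) (i : Fin (n * m * l)) : Fin (n * (m * l)) :=
  Fin.cast (Nat.mul_assoc n m l) i

/-- The inverse change of bracketing of a product index. -/
def assocIndexInv (n m l : ℕ) (i : Fin (n * (m * l))) : Fin (n * m * l) :=
  Fin.cast (Nat.mul_assoc n m l).symm i

section assocIndex

variable {n m l : ℕ}

/-- This and its companions say that the three digits of a mixed radix number do not depend on the
bracketing of the radices. -/
theorem assocIndexInv_modNat (i : Fin (n * (m * l))) :
    (assocIndexInv n m l i).modNat = i.modNat.modNat := by
  apply Fin.ext
  simp [assocIndexInv, Fin.modNat]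

theorem assocIndexInv_divNat_modNat (i : Fin (n * (m * l))) :
    (assocIndexInv n m l i).divNat.modNat = i.modNat.divNat := by
  apply Fin.ext
  simp [assocIndexInv, Fin.modNat, Fin.divNat, Nat.mod_mul_left_div_self]

theorem assocIndexInv_divNat_divNat (i : Fin (n * (m * l))) :
    (assocIndexInv n m l i).divNat.divNat = i.divNat := by
  apply Fin.ext
  simp [assocIndexInv, Fin.divNat, Nat.div_div_eq_div_mul, Nat.mul_comm]

theorem assocIndex_divNat (i : Fin (n * m * l)) : (assocIndex n m l i).divNat = i.divNat.divNat :=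
  (assocIndexInv_divNat_divNat (assocIndex n m l i)).symm

theorem assocIndex_modNat_divNat (i : Fin (n * m * l)) :
    (assocIndex n m l i).modNat.divNat = i.divNat.modNat :=
  (assocIndexInv_divNat_modNat (assocIndex n m l i)).symm

theorem assocIndex_modNat_modNat (i : Fin (n * m * l)) :
    (assocIndex n m l i).modNat.modNat = i.modNat :=
  (assocIndexInv_modNat (assocIndex n m l i)).symm

end assocIndex

theorem tensorMat_mul_onMatrix {ρ₁ ρ₂ σ : NetMorphism N} (hσ : σ.Valued)
    {T : Matrix (Fin ρ₂.mult) (Fin ρ₁.mult) (H →L[ℂ] H)} (hT : T * ρ₁.hom 1 = T) {m : ℕ}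
    (S : Matrix (Fin m) (Fin σ.mult) N.quasilocal) (A : N.quasilocal) :
    tensorMat ρ₁ ρ₂ T S * ρ₁.onMatrix (σ.value hσ A) = tensorMat ρ₁ ρ₂ T (S * σ.value hσ A) := by
  rw [← tensorMat_one, tensorMat_mul (IsIntertwiner.id ρ₁), hT]

/-- Up to bracketing of the indices, both sides have the entries of `f · ρ₁(g · σ₁(k))`, with `ρ₁`
and `σ₁` applied entrywise. -/
theorem LTBimod.tensorHom_assoc {ρ₁ ρ₂ σ₁ σ₂ τ₁ τ₂ : LTBimod N} (f : ρ₁ ⟶ ρ₂) (g : σ₁ ⟶ σ₂)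
    (k : τ₁ ⟶ τ₂) :
    tensorHom (tensorHom f g) k ≫ eqToHom (tensor_assoc ρ₂ σ₂ τ₂)
      = eqToHom (tensor_assoc ρ₁ σ₁ τ₁) ≫ tensorHom f (tensorHom g k) := by
  apply hom_ext
  rw [comp_eqToHom_mat, eqToHom_comp_mat]
  have hL : ∀ (i : Fin (τ₂.mult * (σ₂.mult * ρ₂.mult))) (j : Fin (τ₁.mult * (σ₁.mult * ρ₁.mult))),
      (tensorHom (tensorHom f g) k).mat i j
        = (f.mat * ρ₁.hom ((Hom.value g * σ₁.value σ₁.valued (Hom.value k i.divNat j.divNat))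
            i.modNat.divNat j.modNat.divNat)) i.modNat.modNat j.modNat.modNat := fun i j =>
    congrFun (congrFun (tensorMat_mul_onMatrix σ₁.valued (T := f.mat) f.isIntertwiner.mul_one (Hom.value g)
      (Hom.value k i.divNat j.divNat)) i.modNat) j.modNat
  have hv : ∀ (i : Fin (τ₂.mult * σ₂.mult)) (j : Fin (τ₁.mult * σ₁.mult)),
      Hom.value (tensorHom g k) i j
        = (Hom.value g * σ₁.value σ₁.valued (Hom.value k i.divNat j.divNat))
            i.modNat j.modNat := by
    intro i j
    apply Subtype.ext
    rw [Matrix.mul_apply, AddSubmonoidClass.coe_finsetSum]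
    rfl
  have hR : ∀ (i : Fin (τ₂.mult * σ₂.mult * ρ₂.mult)) (j : Fin (τ₁.mult * σ₁.mult * ρ₁.mult)),
      (tensorHom f (tensorHom g k)).mat i j
        = (f.mat * ρ₁.hom ((Hom.value g * σ₁.value σ₁.valued
            (Hom.value k i.divNat.divNat j.divNat.divNat))
              i.divNat.modNat j.divNat.modNat)) i.modNat j.modNat := by
    intro i j
    rw [← hv]
    rfl
  have key : ∀ (i : Fin (τ₂.mult * σ₂.mult * ρ₂.mult))
      (j : Fin (τ₁.mult * (σ₁.mult * ρ₁.mult))),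
      (tensorHom (tensorHom f g) k).mat (assocIndex _ _ _ i) j
        = (tensorHom f (tensorHom g k)).mat i (assocIndexInv _ _ _ j) := by
    intro i j
    refine (hL _ j).trans (Eq.trans ?_ (hR i _).symm)
    rw [assocIndex_divNat, assocIndex_modNat_divNat, assocIndex_modNat_modNat, assocIndexInv_modNat,
      assocIndexInv_divNat_modNat, assocIndexInv_divNat_divNat]
  exact Matrix.ext key

theorem LTBimod.tensorHom_assoc_symm {ρ₁ ρ₂ σ₁ σ₂ τ₁ τ₂ : LTBimod N} (f : ρ₁ ⟶ ρ₂)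
    (g : σ₁ ⟶ σ₂) (k : τ₁ ⟶ τ₂) :
    tensorHom f (tensorHom g k) ≫ eqToHom (tensor_assoc ρ₂ σ₂ τ₂).symm
      = eqToHom (tensor_assoc ρ₁ σ₁ τ₁).symm ≫ tensorHom (tensorHom f g) k := by
  rw [← cancel_mono (eqToHom (tensor_assoc ρ₂ σ₂ τ₂)), Category.assoc, Category.assoc,
    tensorHom_assoc, eqToHom_trans, eqToHom_refl, Category.comp_id, eqToHom_trans_assoc,
    eqToHom_refl, Category.id_comp]

/-! ### Unitary arrows and transport -/

namespace LTBimod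

theorem IsUnitary.comp_adj {ρ σ : LTBimod N} {U : ρ ⟶ σ} (hU : IsUnitary U) :
    U ≫ adj U = 𝟙 ρ :=
  hom_ext hU.adjoint_mul

theorem IsUnitary.adj_comp {ρ σ : LTBimod N} {U : ρ ⟶ σ} (hU : IsUnitary U) :
    adj U ≫ U = 𝟙 σ :=
  hom_ext hU.mul_adjoint

theorem IsUnitary.tensorHom {ρ₁ ρ₂ σ₁ σ₂ : LTBimod N} {U : ρ₁ ⟶ ρ₂} {V : σ₁ ⟶ σ₂}
    (hU : IsUnitary U) (hV : IsUnitary V) : IsUnitary (LTBimod.tensorHom U V) :=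
  IsUnitaryIntertwiner.tensor σ₁.valued σ₂.valued hU hV

theorem isUnitary_id (ρ : LTBimod N) : IsUnitary (𝟙 ρ) where
  toIsIntertwiner := (𝟙 ρ : ρ ⟶ ρ).isIntertwiner
  adjoint_mul := by
    rw [id_mat, NetMorphism.conjTranspose_hom, star_one, ← map_mul, mul_one]
  mul_adjoint := by
    rw [id_mat, NetMorphism.conjTranspose_hom, star_one, ← map_mul, mul_one]

end LTBimod

theorem IsUnitaryIntertwiner.symm {ρ σ : NetMorphism N}
    {U : Matrix (Fin σ.mult) (Fin ρ.mult) (H →L[ℂ] H)} (hU : IsUnitaryIntertwiner ρ σ U) :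
    IsUnitaryIntertwiner σ ρ U.conjTranspose where
  toIsIntertwiner := hU.toIsIntertwiner.adjoint
  adjoint_mul := by rw [Matrix.conjTranspose_conjTranspose, hU.mul_adjoint]
  mul_adjoint := by rw [Matrix.conjTranspose_conjTranspose, hU.adjoint_mul]

theorem IsUnitaryIntertwiner.trans {ρ σ τ : NetMorphism N}
    {U : Matrix (Fin σ.mult) (Fin ρ.mult) (H →L[ℂ] H)} (hU : IsUnitaryIntertwiner ρ σ U)
    {V : Matrix (Fin τ.mult) (Fin σ.mult) (H →L[ℂ] H)} (hV : IsUnitaryIntertwiner σ τ V) :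
    IsUnitaryIntertwiner ρ τ (V * U) where
  toIsIntertwiner := hU.toIsIntertwiner.comp hV.toIsIntertwiner
  adjoint_mul := by
    rw [Matrix.conjTranspose_mul, Matrix.mul_assoc, ← Matrix.mul_assoc _ V, hV.adjoint_mul,
      hU.one_mul, hU.adjoint_mul]
  mul_adjoint := by
    rw [Matrix.conjTranspose_mul, Matrix.mul_assoc, ← Matrix.mul_assoc U, hU.mul_adjoint,
      ← Matrix.mul_assoc, hV.mul_one, hV.mul_adjoint]

theorem NetMorphism.Transportable.of_unitary {ρ σ : NetMorphism N} (hρ : ρ.Transportable)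
    {U : Matrix (Fin σ.mult) (Fin ρ.mult) (H →L[ℂ] H)} (hU : IsUnitaryIntertwiner ρ σ U) :
    σ.Transportable := by
  intro o
  obtain ⟨τ, hτ, V, hV⟩ := hρ o
  exact ⟨τ, hτ, _, hU.symm.trans hV⟩

/-- Transportability passes along unitary equivalence, so the transported morphism is again an
object of the category. -/
theorem LTBimod.exists_transport (ρ : LTBimod N) (o : DoubleCone) :
    ∃ (ρ' : LTBimod N) (U : ρ ⟶ ρ'), IsUnitary U ∧ ρ'.LocalizedIn o := by
  obtain ⟨τ, hτ, U, hU⟩ := ρ.transportable o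
  exact ⟨⟨τ, ⟨o, hτ⟩, ρ.transportable.of_unitary hU⟩, ⟨U, hU.toIsIntertwiner⟩, hU, hτ⟩

/-- An object localized in `o` which is unitarily equivalent to `ρ`. -/
def LTBimod.transport (ρ : LTBimod N) (o : DoubleCone) : LTBimod N :=
  (ρ.exists_transport o).choose

/-- The unitary from `ρ` to its transport. -/
def LTBimod.transporter (ρ : LTBimod N) (o : DoubleCone) : ρ ⟶ ρ.transport o :=
  (ρ.exists_transport o).choose_spec.choose

theorem LTBimod.isUnitary_transporter (ρ : LTBimod N) (o : DoubleCone) :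
    IsUnitary (ρ.transporter o) :=
  (ρ.exists_transport o).choose_spec.choose_spec.1

theorem LTBimod.transport_localizedIn (ρ : LTBimod N) (o : DoubleCone) :
    (ρ.transport o).LocalizedIn o :=
  (ρ.exists_transport o).choose_spec.choose_spec.2

/-! ### The symmetry -/

/-- The matrix `(V⁺ × U⁺) θ (U × V)`. -/
def conjTheta {ρ σ ρ₁ σ₁ : LTBimod N} (U : ρ ⟶ ρ₁) (V : σ ⟶ σ₁) :
    Matrix (Fin (σ.tensor ρ).mult) (Fin (ρ.tensor σ).mult) (H →L[ℂ] H) :=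
  (LTBimod.tensorHom (LTBimod.adj V) (LTBimod.adj U)).mat * LTBimod.theta ρ₁ σ₁ *
    (LTBimod.tensorHom U V).mat

/-- The bare `θ` need not be an arrow, but `U × V` supplies the missing projection `ρ₁σ₁(1)`. -/
theorem conjTheta_eq {ρ σ ρ₁ σ₁ : LTBimod N} (U : ρ ⟶ ρ₁) (V : σ ⟶ σ₁)
    (h : SpacelikeLocalized ρ₁ σ₁) :
    conjTheta U V = (LTBimod.tensorHom U V ≫ h.exchange ≫
      LTBimod.tensorHom (LTBimod.adj V) (LTBimod.adj U)).mat := by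
  simp only [LTBimod.comp_mat, SpacelikeLocalized.exchange, Matrix.mul_assoc, conjTheta,
    (LTBimod.tensorHom U V).isIntertwiner.one_mul]

theorem SpacelikeLocalized.exchange_naturality {ρ₁ ρ₂ σ₁ σ₂ : LTBimod N} (f : ρ₁ ⟶ ρ₂)
    (g : σ₁ ⟶ σ₂) {c d : DoubleCone} (hcd : c.Perp d) (hρ₁ : ρ₁.LocalizedIn c)
    (hρ₂ : ρ₂.LocalizedIn c) (hσ₁ : σ₁.LocalizedIn d) (hσ₂ : σ₂.LocalizedIn d)
    (h₁ : SpacelikeLocalized ρ₁ σ₁) (h₂ : SpacelikeLocalized ρ₂ σ₂) :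
    LTBimod.tensorHom f g ≫ h₂.exchange = h₁.exchange ≫ LTBimod.tensorHom g f := by
  apply LTBimod.hom_ext
  simp only [LTBimod.comp_mat, exchange]
  rw [Matrix.mul_assoc, (LTBimod.tensorHom f g).isIntertwiner.one_mul, ← Matrix.mul_assoc,
    ← LTBimod.theta_mul_tensorHom f g hcd hρ₁ hρ₂ hσ₁ hσ₂, Matrix.mul_assoc,
    (LTBimod.tensorHom f g).isIntertwiner.mul_one]

/-- The two choices differ by the arrows `U₂U₁⁺` and `V₂V₁⁺` between objects localized in `c` and in
`d`. Naturality of the exchange moves these arrows to the other side, where they cancel. -/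
theorem conjTheta_congr {ρ σ ρ₁ σ₁ ρ₂ σ₂ : LTBimod N} {U₁ : ρ ⟶ ρ₁} {V₁ : σ ⟶ σ₁}
    {U₂ : ρ ⟶ ρ₂} {V₂ : σ ⟶ σ₂} (hU₁ : LTBimod.IsUnitary U₁) (hV₁ : LTBimod.IsUnitary V₁)
    (hU₂ : LTBimod.IsUnitary U₂) (hV₂ : LTBimod.IsUnitary V₂) {c d : DoubleCone}
    (hcd : c.Perp d) (hρ₁ : ρ₁.LocalizedIn c) (hρ₂ : ρ₂.LocalizedIn c)
    (hσ₁ : σ₁.LocalizedIn d) (hσ₂ : σ₂.LocalizedIn d) : conjTheta U₁ V₁ = conjTheta U₂ V₂ := by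
  have h₁ : SpacelikeLocalized ρ₁ σ₁ := ⟨c, d, hcd, hρ₁, hσ₁⟩
  have h₂ : SpacelikeLocalized ρ₂ σ₂ := ⟨c, d, hcd, hρ₂, hσ₂⟩
  rw [conjTheta_eq _ _ h₁, conjTheta_eq _ _ h₂]
  congr 1
  have e1 : U₁ ≫ LTBimod.adj U₁ ≫ U₂ = U₂ := by
    rw [← Category.assoc, hU₁.comp_adj, Category.id_comp]
  have e2 : V₁ ≫ LTBimod.adj V₁ ≫ V₂ = V₂ := by
    rw [← Category.assoc, hV₁.comp_adj, Category.id_comp]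
  have e3 : (LTBimod.adj U₁ ≫ U₂) ≫ LTBimod.adj U₂ = LTBimod.adj U₁ := by
    rw [Category.assoc, hU₂.comp_adj, Category.comp_id]
  have e4 : (LTBimod.adj V₁ ≫ V₂) ≫ LTBimod.adj V₂ = LTBimod.adj V₁ := by
    rw [Category.assoc, hV₂.comp_adj, Category.comp_id]
  have key := SpacelikeLocalized.exchange_naturality (LTBimod.adj U₁ ≫ U₂)
    (LTBimod.adj V₁ ≫ V₂) hcd hρ₁ hρ₂ hσ₁ hσ₂ h₁ h₂
  rw [← e3, ← e4, LTBimod.tensorHom_comp, ← reassoc_of% key, ← Category.assoc,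
    ← LTBimod.tensorHom_comp, e1, e2]

theorem exists_perp_pair : ∃ p : DoubleCone × DoubleCone, p.1.Perp p.2 := by
  obtain ⟨o, ho⟩ := (diamond 0 1 one_pos).exists_perp
  exact ⟨(o, _), ho⟩

/-- The first of two spacelike separated reference double cones. -/
def leftCone : DoubleCone :=
  exists_perp_pair.choose.1

/-- The second of two spacelike separated reference double cones. -/
def rightCone : DoubleCone :=
  exists_perp_pair.choose.2

theorem leftCone_perp_rightCone : leftCone.Perp rightCone :=
  exists_perp_pair.choose_spec

theorem spacelikeLocalized_transport (ρ σ : LTBimod N) :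
    SpacelikeLocalized (ρ.transport leftCone) (σ.transport rightCone) :=
  ⟨_, _, leftCone_perp_rightCone, ρ.transport_localizedIn _, σ.transport_localizedIn _⟩

/-- The exchange of the factors of a product, defined by transport to spacelike separated
double cones. -/
def braiding (ρ σ : LTBimod N) : ρ.tensor σ ⟶ σ.tensor ρ :=
  LTBimod.tensorHom (ρ.transporter leftCone) (σ.transporter rightCone) ≫
    (spacelikeLocalized_transport ρ σ).exchange ≫
      LTBimod.tensorHom (LTBimod.adj (σ.transporter rightCone))
        (LTBimod.adj (ρ.transporter leftCone))

/-- Independence of all choices: connectedness changes the pair of cones, and `conjTheta_congr`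
changes the unitaries over a fixed pair. -/
theorem braiding_mat {ρ σ ρ₁ σ₁ : LTBimod N} {U : ρ ⟶ ρ₁} {V : σ ⟶ σ₁}
    (hU : LTBimod.IsUnitary U) (hV : LTBimod.IsUnitary V) (h : SpacelikeLocalized ρ₁ σ₁) :
    (braiding ρ σ).mat = conjTheta U V := by
  obtain ⟨o, a, hoa, hρ₁, hσ₁⟩ := h
  rw [braiding, ← conjTheta_eq]
  let E : DoubleCone → DoubleCone →
      Matrix (Fin (σ.tensor ρ).mult) (Fin (ρ.tensor σ).mult) (H →L[ℂ] H) :=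
    fun c d => conjTheta (ρ.transporter c) (σ.transporter d)
  -- The transporters are arbitrary choices, unrelated for different cones. This is harmless, since
  -- an object localized in `o` is also localized in the larger `c`.
  have hE : ∀ o a c d : DoubleCone, o.carrier ⊆ c.carrier → a.carrier ⊆ d.carrier → c.Perp d →
      E o a = E c d := fun o a c d hoc had hcd =>
    conjTheta_congr (ρ.isUnitary_transporter _) (σ.isUnitary_transporter _)
      (ρ.isUnitary_transporter _) (σ.isUnitary_transporter _) hcd
      ((ρ.transport_localizedIn o).mono hoc) (ρ.transport_localizedIn c)
      ((σ.transport_localizedIn a).mono had) (σ.transport_localizedIn d)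
  refine (DoubleCone.Perp.connected E hE leftCone_perp_rightCone hoa).trans ?_
  exact conjTheta_congr (ρ.isUnitary_transporter _) (σ.isUnitary_transporter _) hU hV hoa
    (ρ.transport_localizedIn o) hρ₁ (σ.transport_localizedIn a) hσ₁

theorem braiding_eq {ρ σ ρ₁ σ₁ : LTBimod N} {U : ρ ⟶ ρ₁} {V : σ ⟶ σ₁}
    (hU : LTBimod.IsUnitary U) (hV : LTBimod.IsUnitary V) (h : SpacelikeLocalized ρ₁ σ₁) :
    braiding ρ σ = LTBimod.tensorHom U V ≫ h.exchange ≫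
      LTBimod.tensorHom (LTBimod.adj V) (LTBimod.adj U) :=
  LTBimod.hom_ext ((braiding_mat hU hV h).trans (conjTheta_eq U V h))

/-! ### Normalization, naturality, adjoint and symmetry of the braiding -/

theorem LTBimod.adj_id (ρ : LTBimod N) : adj (𝟙 ρ) = 𝟙 ρ :=
  hom_ext (by
    change (ρ.hom 1).conjTranspose = ρ.hom 1
    rw [NetMorphism.conjTranspose_hom, star_one])

theorem SpacelikeLocalized.braiding_eq {ρ σ : LTBimod N} (h : SpacelikeLocalized ρ σ) :
    braiding ρ σ = h.exchange := by
  rw [DHR.braiding_eq (LTBimod.isUnitary_id ρ) (LTBimod.isUnitary_id σ) h, LTBimod.adj_id,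
    LTBimod.adj_id, LTBimod.tensorHom_id, LTBimod.tensorHom_id, Category.comp_id,
    Category.id_comp]

/-- Conjugation by the transporters turns `T` and `S` into arrows between objects in the two
reference cones, where the exchange is natural. -/
theorem braiding_naturality {τ ρ β σ : LTBimod N} (T : τ ⟶ ρ) (S : β ⟶ σ) :
    LTBimod.tensorHom T S ≫ braiding ρ σ = braiding τ β ≫ LTBimod.tensorHom S T := by
  have key := SpacelikeLocalized.exchange_naturality
    (LTBimod.adj (τ.transporter leftCone) ≫ T ≫ ρ.transporter leftCone)
    (LTBimod.adj (β.transporter rightCone) ≫ S ≫ σ.transporter rightCone)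
    leftCone_perp_rightCone (τ.transport_localizedIn _) (ρ.transport_localizedIn _)
    (β.transport_localizedIn _) (σ.transport_localizedIn _)
    (spacelikeLocalized_transport τ β) (spacelikeLocalized_transport ρ σ)
  have e1 : τ.transporter leftCone ≫ LTBimod.adj (τ.transporter leftCone) ≫ T ≫
      ρ.transporter leftCone = T ≫ ρ.transporter leftCone := by
    rw [← Category.assoc, (τ.isUnitary_transporter _).comp_adj, Category.id_comp]
  have e2 : β.transporter rightCone ≫ LTBimod.adj (β.transporter rightCone) ≫ S ≫
      σ.transporter rightCone = S ≫ σ.transporter rightCone := by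
    rw [← Category.assoc, (β.isUnitary_transporter _).comp_adj, Category.id_comp]
  have e3 : (LTBimod.adj (τ.transporter leftCone) ≫ T ≫ ρ.transporter leftCone) ≫
      LTBimod.adj (ρ.transporter leftCone) = LTBimod.adj (τ.transporter leftCone) ≫ T := by
    rw [Category.assoc, Category.assoc, (ρ.isUnitary_transporter _).comp_adj, Category.comp_id]
  have e4 : (LTBimod.adj (β.transporter rightCone) ≫ S ≫ σ.transporter rightCone) ≫
      LTBimod.adj (σ.transporter rightCone) = LTBimod.adj (β.transporter rightCone) ≫ S := by
    rw [Category.assoc, Category.assoc, (σ.isUnitary_transporter _).comp_adj, Category.comp_id]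
  rw [braiding, braiding, ← Category.assoc (LTBimod.tensorHom T S), ← LTBimod.tensorHom_comp,
    ← e1, ← e2, LTBimod.tensorHom_comp, Category.assoc, reassoc_of% key,
    ← LTBimod.tensorHom_comp, e3, e4]
  simp only [Category.assoc, ← LTBimod.tensorHom_comp]

theorem SpacelikeLocalized.symm {ρ σ : LTBimod N} (h : SpacelikeLocalized ρ σ) :
    SpacelikeLocalized σ ρ := by
  obtain ⟨o, a, hoa, hρ, hσ⟩ := h
  exact ⟨a, o, hoa.symm, hσ, hρ⟩

theorem SpacelikeLocalized.adj_exchange {ρ σ : LTBimod N} (h : SpacelikeLocalized ρ σ) :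
    LTBimod.adj h.exchange = h.symm.exchange := by
  apply LTBimod.hom_ext
  change (LTBimod.theta ρ σ * (ρ.tensor σ).hom 1).conjTranspose = _
  rw [h.theta_mul_hom, Matrix.conjTranspose_mul, NetMorphism.conjTranspose_hom, star_one]
  exact congrArg (· * (σ.tensor ρ).hom 1) (theta_conjTranspose ρ.mult σ.mult)

theorem SpacelikeLocalized.exchange_exchange {ρ σ : LTBimod N} (h : SpacelikeLocalized ρ σ) :
    h.exchange ≫ h.symm.exchange = 𝟙 (ρ.tensor σ) := by
  apply LTBimod.hom_ext
  change LTBimod.theta σ ρ * (σ.tensor ρ).hom 1 * (LTBimod.theta ρ σ * (ρ.tensor σ).hom 1) = _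
  rw [Matrix.mul_assoc, h.isIntertwiner.one_mul]
  exact theta_mul_theta _

/-- Taking the adjoint leaves `σ` in the right cone and `ρ` in the left one, the opposite of the
defining choice for `ε(σ,ρ)`. Independence of the choice makes this irrelevant. -/
theorem adj_braiding (ρ σ : LTBimod N) : LTBimod.adj (braiding ρ σ) = braiding σ ρ := by
  rw [braiding_eq (σ.isUnitary_transporter _) (ρ.isUnitary_transporter _)
    (spacelikeLocalized_transport ρ σ).symm, braiding]
  simp only [LTBimod.adj_comp, LTBimod.adj_tensorHom, LTBimod.adj_adj,
    SpacelikeLocalized.adj_exchange, Category.assoc]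

theorem braiding_braiding (ρ σ : LTBimod N) :
    braiding σ ρ ≫ braiding ρ σ = 𝟙 (σ.tensor ρ) := by
  have h := spacelikeLocalized_transport ρ σ
  have hU := ρ.isUnitary_transporter leftCone
  have hV := σ.isUnitary_transporter rightCone
  have hx : h.symm.exchange ≫ h.exchange = 𝟙 _ := h.symm.exchange_exchange
  rw [braiding_eq hV hU h.symm, braiding_eq hU hV h, Category.assoc, Category.assoc,
    ← Category.assoc (LTBimod.tensorHom _ _) (LTBimod.tensorHom _ _),
    ← LTBimod.tensorHom_comp, hU.adj_comp, hV.adj_comp, LTBimod.tensorHom_id, Category.id_comp,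
    reassoc_of% hx, ← LTBimod.tensorHom_comp, hU.comp_adj, hV.comp_adj, LTBimod.tensorHom_id]

/-! ### The braiding with a product -/

/-- The exchange of the first factor with the product of the other two, one factor at a time,
for given exchanges of `ρ` and `τ` and of `ρ` and `σ`. -/
def exchangeTensor {ρ τ σ : LTBimod N} (x : ρ.tensor τ ⟶ τ.tensor ρ)
    (y : ρ.tensor σ ⟶ σ.tensor ρ) : ρ.tensor (τ.tensor σ) ⟶ (τ.tensor σ).tensor ρ :=
  eqToHom (LTBimod.tensor_assoc ρ τ σ).symm ≫ LTBimod.tensorHom x (𝟙 σ) ≫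
    eqToHom (LTBimod.tensor_assoc τ ρ σ) ≫ LTBimod.tensorHom (𝟙 τ) y ≫
      eqToHom (LTBimod.tensor_assoc τ σ ρ).symm

/-- This serves to carry the identity for `ε(ρ, τσ)` from spacelike localized objects to arbitrary
ones: the three arrows pass through each factor in turn. -/
theorem exchangeTensor_naturality {ρ τ σ ρ' τ' σ' : LTBimod N} {x : ρ.tensor τ ⟶ τ.tensor ρ}
    {y : ρ.tensor σ ⟶ σ.tensor ρ} {x' : ρ'.tensor τ' ⟶ τ'.tensor ρ'}
    {y' : ρ'.tensor σ' ⟶ σ'.tensor ρ'} {f : ρ ⟶ ρ'} {g : τ ⟶ τ'} {k : σ ⟶ σ'}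
    (hx : LTBimod.tensorHom f g ≫ x' = x ≫ LTBimod.tensorHom g f)
    (hy : LTBimod.tensorHom f k ≫ y' = y ≫ LTBimod.tensorHom k f) :
    LTBimod.tensorHom f (LTBimod.tensorHom g k) ≫ exchangeTensor x' y'
      = exchangeTensor x y ≫ LTBimod.tensorHom (LTBimod.tensorHom g k) f := by
  have a1 := LTBimod.tensorHom_assoc_symm f g k
  have a2 := LTBimod.tensorHom_assoc g f k
  have a3 := LTBimod.tensorHom_assoc_symm g k f
  have b1 : LTBimod.tensorHom (LTBimod.tensorHom f g) k ≫ LTBimod.tensorHom x' (𝟙 σ')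
      = LTBimod.tensorHom x (𝟙 σ) ≫ LTBimod.tensorHom (LTBimod.tensorHom g f) k := by
    rw [← LTBimod.tensorHom_comp, ← LTBimod.tensorHom_comp, hx, Category.comp_id,
      Category.id_comp]
  have b2 : LTBimod.tensorHom g (LTBimod.tensorHom f k) ≫ LTBimod.tensorHom (𝟙 τ') y'
      = LTBimod.tensorHom (𝟙 τ) y ≫ LTBimod.tensorHom g (LTBimod.tensorHom k f) := by
    rw [← LTBimod.tensorHom_comp, ← LTBimod.tensorHom_comp, hy, Category.comp_id,
      Category.id_comp]
  simp only [exchangeTensor, Category.assoc]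
  rw [reassoc_of% a1, reassoc_of% b1, reassoc_of% a2, reassoc_of% b2, a3]

/-- The product index with given components. -/
def tripleIndex {n m l : ℕ} (a : Fin n) (b : Fin m) (c : Fin l) : Fin (n * m * l) :=
  finProdFinEquiv (finProdFinEquiv (a, b), c)

/-! ### Exchanges in threefold products -/

theorem finProdFinEquiv_divNat {n m : ℕ} (x : Fin n × Fin m) : (finProdFinEquiv x).divNat = x.1 :=
  congrArg Prod.fst (finProdFinEquiv.symm_apply_apply x)

theorem finProdFinEquiv_modNat {n m : ℕ} (x : Fin n × Fin m) : (finProdFinEquiv x).modNat = x.2 :=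
  congrArg Prod.snd (finProdFinEquiv.symm_apply_apply x)

theorem LTBimod.tensor_tensor_hom_tripleIndex (τ ρ σ : LTBimod N) (A : N.quasilocal)
    (a a' : Fin σ.mult) (b b' : Fin ρ.mult) (c c' : Fin τ.mult) :
    (τ.tensor (ρ.tensor σ)).hom A (tripleIndex a b c) (tripleIndex a' b' c')
      = τ.hom (ρ.value ρ.valued (σ.value σ.valued A a a') b b') c c' := by
  change τ.hom (ρ.value ρ.valued (σ.value σ.valued A (tripleIndex a b c).divNat.divNat
    (tripleIndex a' b' c').divNat.divNat) (tripleIndex a b c).divNat.modNat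
    (tripleIndex a' b' c').divNat.modNat) (tripleIndex a b c).modNat
    (tripleIndex a' b' c').modNat = _
  simp only [tripleIndex, finProdFinEquiv_divNat, finProdFinEquiv_modNat]

theorem tripleIndex_eta {n m l : ℕ} (i : Fin (n * m * l)) :
    tripleIndex i.divNat.divNat i.divNat.modNat i.modNat = i := by
  refine ext_divNat_modNat (ext_divNat_modNat ?_ ?_) ?_ <;>
  simp only [tripleIndex, finProdFinEquiv_divNat, finProdFinEquiv_modNat]

theorem SpacelikeLocalized.exchange_apply {ρ σ : LTBimod N} (h : SpacelikeLocalized ρ σ)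
    (i : Fin (ρ.mult * σ.mult)) (j : Fin (σ.mult * ρ.mult)) :
    h.exchange.mat i j = ρ.hom (σ.value σ.valued 1 i.modNat j.divNat) i.divNat j.modNat := by
  refine (congrFun (congrFun (theta_mul ((ρ.tensor σ).hom 1)) i) j).trans ?_
  change ρ.hom (σ.value σ.valued 1 (pairSwap _ _ i).divNat j.divNat) (pairSwap _ _ i).modNat
    j.modNat = _
  rw [pairSwap_divNat, pairSwap_modNat]

theorem SpacelikeLocalized.exchange_mul_hom_apply {ρ σ : LTBimod N} (h : SpacelikeLocalized ρ σ)
    (A : N.quasilocal) (i : Fin (ρ.mult * σ.mult)) (j : Fin (σ.mult * ρ.mult)) :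
    (h.exchange.mat * (ρ.tensor σ).hom A) i j
      = σ.hom (ρ.value ρ.valued A i.divNat j.modNat) i.modNat j.divNat := by
  have h1 : h.exchange.mat * (ρ.tensor σ).hom A
      = (σ.tensor ρ).hom A * LTBimod.theta ρ σ := by
    rw [exchange, Matrix.mul_assoc, ← map_mul, one_mul, h.theta_mul_hom]
  rw [h1]
  refine (congrFun (congrFun (mul_theta ((σ.tensor ρ).hom A)) i) j).trans ?_
  change σ.hom (ρ.value ρ.valued A i.divNat (pairSwap _ _ j).divNat) i.modNat
    (pairSwap _ _ j).modNat = _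
  rw [pairSwap_divNat, pairSwap_modNat]

/-- The first partial exchange is written as the projection `τρσ(1)` with permuted columns, by
moving `θ` to the right. The second, below, is the same projection with permuted rows, so their
product can be evaluated by idempotence. -/
theorem SpacelikeLocalized.tensorHom_exchange_id_mat {ρ τ : LTBimod N}
    (h : SpacelikeLocalized ρ τ) (σ : LTBimod N) :
    (LTBimod.tensorHom h.exchange (𝟙 σ) ≫ eqToHom (LTBimod.tensor_assoc τ ρ σ)).mat
      = ((τ.tensor (ρ.tensor σ)).hom 1).submatrix id
        fun j : Fin (σ.mult * (τ.mult * ρ.mult)) =>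
          tripleIndex j.divNat j.modNat.modNat j.modNat.divNat := by
  rw [LTBimod.comp_eqToHom_mat]
  have h1 : ∀ (i : Fin (σ.mult * (ρ.mult * τ.mult))) (j : Fin (σ.mult * (τ.mult * ρ.mult))),
      (LTBimod.tensorHom h.exchange (𝟙 σ)).mat i j
        = τ.hom (ρ.value ρ.valued (σ.value σ.valued 1 i.divNat j.divNat) i.modNat.divNat
          j.modNat.modNat) i.modNat.modNat j.modNat.divNat := fun i j =>
    h.exchange_mul_hom_apply _ i.modNat j.modNat
  have key : ∀ (i : Fin (σ.mult * ρ.mult * τ.mult)) (j : Fin (σ.mult * (τ.mult * ρ.mult))),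
      (LTBimod.tensorHom h.exchange (𝟙 σ)).mat (assocIndex _ _ _ i) j
        = (τ.tensor (ρ.tensor σ)).hom 1 i
          (tripleIndex j.divNat j.modNat.modNat j.modNat.divNat) := by
    intro i j
    refine (h1 _ j).trans ?_
    rw [assocIndex_divNat, assocIndex_modNat_divNat, assocIndex_modNat_modNat]
    obtain ⟨a, b, c, rfl⟩ : ∃ a b c, tripleIndex a b c = i := ⟨_, _, _, tripleIndex_eta i⟩
    refine Eq.trans ?_ (LTBimod.tensor_tensor_hom_tripleIndex τ ρ σ 1 a _ b _ c _).symm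
    simp only [tripleIndex, finProdFinEquiv_divNat, finProdFinEquiv_modNat]
  exact Matrix.ext key

theorem SpacelikeLocalized.tensorHom_id_exchange_mat {ρ σ : LTBimod N}
    (h : SpacelikeLocalized ρ σ) (τ : LTBimod N) :
    (LTBimod.tensorHom (𝟙 τ) h.exchange ≫ eqToHom (LTBimod.tensor_assoc τ σ ρ).symm).mat
      = ((τ.tensor (ρ.tensor σ)).hom 1).submatrix
        (fun i : Fin (ρ.mult * (σ.mult * τ.mult)) =>
          tripleIndex i.modNat.divNat i.divNat i.modNat.modNat) id := by
  rw [LTBimod.comp_eqToHom_mat]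
  have key : ∀ (i : Fin (ρ.mult * (σ.mult * τ.mult))) (j : Fin (σ.mult * ρ.mult * τ.mult)),
      (LTBimod.tensorHom (𝟙 τ) h.exchange).mat (assocIndexInv _ _ _ i) j
        = (τ.tensor (ρ.tensor σ)).hom 1
          (tripleIndex i.modNat.divNat i.divNat i.modNat.modNat) j := by
    intro i j
    have h1 : LTBimod.Hom.value h.exchange (assocIndexInv _ _ _ i).divNat j.divNat
        = ρ.value ρ.valued (σ.value σ.valued 1 i.modNat.divNat j.divNat.divNat) i.divNat
          j.divNat.modNat := by
      apply Subtype.ext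
      refine (h.exchange_apply _ _).trans ?_
      rw [assocIndexInv_divNat_divNat, assocIndexInv_divNat_modNat]
      rfl
    refine (congrFun (congrFun (tensorMat_one τ.toNetMorphism (LTBimod.Hom.value h.exchange))
      (assocIndexInv _ _ _ i)) j).trans ?_
    change τ.hom (LTBimod.Hom.value h.exchange (assocIndexInv _ _ _ i).divNat
      j.divNat) (assocIndexInv _ _ _ i).modNat j.modNat = _
    rw [h1, assocIndexInv_modNat]
    obtain ⟨a, b, c, rfl⟩ : ∃ a b c, tripleIndex a b c = j := ⟨_, _, _, tripleIndex_eta j⟩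
    refine Eq.trans ?_ (LTBimod.tensor_tensor_hom_tripleIndex τ ρ σ 1 _ a _ b _ c).symm
    simp only [tripleIndex, finProdFinEquiv_divNat, finProdFinEquiv_modNat]
  exact Matrix.ext key

theorem submatrix_mul_submatrix_of_idempotent {R κ ι ι' : Type*} [NonUnitalNonAssocSemiring R]
    [Fintype κ] (M : Matrix κ κ R) (hM : M * M = M) (r : ι → κ) (q : ι' → κ) :
    M.submatrix r id * M.submatrix id q = M.submatrix r q := by
  rw [← Matrix.submatrix_mul _ _ _ _ _ Function.bijective_id, hM]

/-- The composite of the partial exchanges is `τρσ(1)` with rows and columns permuted. The direct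
exchange has the entries of `ρτσ(1)`, and these agree because `ρ` and `τ` commute on the entries of
`σ(1)`. -/
theorem SpacelikeLocalized.exchange_tensor {ρ τ σ : LTBimod N} (h : SpacelikeLocalized ρ τ)
    (h' : SpacelikeLocalized ρ σ) (h'' : SpacelikeLocalized ρ (τ.tensor σ)) :
    h''.exchange = exchangeTensor h.exchange h'.exchange := by
  have e : exchangeTensor h.exchange h'.exchange = eqToHom (LTBimod.tensor_assoc ρ τ σ).symm ≫
      (LTBimod.tensorHom h.exchange (𝟙 σ) ≫ eqToHom (LTBimod.tensor_assoc τ ρ σ)) ≫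
      (LTBimod.tensorHom (𝟙 τ) h'.exchange ≫ eqToHom (LTBimod.tensor_assoc τ σ ρ).symm) := by
    simp only [exchangeTensor, Category.assoc]
  apply LTBimod.hom_ext
  rw [e, LTBimod.eqToHom_comp_mat, LTBimod.comp_mat, h.tensorHom_exchange_id_mat,
    h'.tensorHom_id_exchange_mat]
  have hmul := submatrix_mul_submatrix_of_idempotent ((τ.tensor (ρ.tensor σ)).hom 1)
    (by rw [← map_mul, mul_one])
    (fun i : Fin (ρ.mult * (σ.mult * τ.mult)) =>
      tripleIndex i.modNat.divNat i.divNat i.modNat.modNat)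
    (fun j : Fin (σ.mult * (τ.mult * ρ.mult)) =>
      tripleIndex j.divNat j.modNat.modNat j.modNat.divNat)
  have key : ∀ (i : Fin (ρ.mult * (σ.mult * τ.mult))) (j : Fin (σ.mult * τ.mult * ρ.mult)),
      h''.exchange.mat i j = (τ.tensor (ρ.tensor σ)).hom 1
        (tripleIndex i.modNat.divNat i.divNat i.modNat.modNat)
        (tripleIndex (assocIndex _ _ _ j).divNat (assocIndex _ _ _ j).modNat.modNat
          (assocIndex _ _ _ j).modNat.divNat) := by
    intro i j
    refine (h''.exchange_apply i j).trans ?_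
    rw [assocIndex_divNat, assocIndex_modNat_divNat, assocIndex_modNat_modNat]
    exact (h.hom_hom_comm (σ.value σ.valued 1 i.modNat.divNat j.divNat.divNat) i.divNat
      j.modNat i.modNat.modNat j.divNat.modNat).trans
      (LTBimod.tensor_tensor_hom_tripleIndex τ ρ σ 1 _ _ _ _ _ _).symm
  exact (Matrix.ext key).trans (congrArg (fun M : Matrix (Fin (ρ.mult * (σ.mult * τ.mult)))
    (Fin (σ.mult * (τ.mult * ρ.mult))) (H →L[ℂ] H) => M.submatrix id (assocIndex _ _ _)) hmul.symm)

theorem braiding_tensor (ρ τ σ : LTBimod N) :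
    braiding ρ (τ.tensor σ) = exchangeTensor (braiding ρ τ) (braiding ρ σ) := by
  have h := spacelikeLocalized_transport ρ τ
  have h' := spacelikeLocalized_transport ρ σ
  have h'' : SpacelikeLocalized (ρ.transport leftCone)
      ((τ.transport rightCone).tensor (σ.transport rightCone)) :=
    ⟨_, _, leftCone_perp_rightCone, ρ.transport_localizedIn _,
      (τ.transport_localizedIn _).tensor (σ.transport_localizedIn _)⟩
  have hU := ρ.isUnitary_transporter leftCone
  have hW := (τ.isUnitary_transporter rightCone).tensorHom (σ.isUnitary_transporter rightCone)
  have e1 := exchangeTensor_naturality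
    (braiding_naturality (ρ.transporter leftCone) (τ.transporter rightCone))
    (braiding_naturality (ρ.transporter leftCone) (σ.transporter rightCone))
  have e2 := braiding_naturality (ρ.transporter leftCone)
    (LTBimod.tensorHom (τ.transporter rightCone) (σ.transporter rightCone))
  rw [h''.braiding_eq, h.exchange_tensor h' h'', ← h.braiding_eq, ← h'.braiding_eq, e1] at e2
  -- Both candidates now agree after composition with a product of transporters, which is unitary
  -- and can be cancelled.
  have e3 := congrArg (· ≫ LTBimod.adj (LTBimod.tensorHom (LTBimod.tensorHom
    (τ.transporter rightCone) (σ.transporter rightCone)) (ρ.transporter leftCone))) e2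
  simp only [Category.assoc, (hW.tensorHom hU).comp_adj, Category.comp_id] at e3
  exact e3.symm

/-- The symmetry of the category of localized transportable bimodules. -/
def braidingSymmetry (N : ReferenceNet H) : Symmetry N where
  ε := braiding
  naturality := braiding_naturality
  adjoint := adj_braiding
  tensor := braiding_tensor
  symmetric := braiding_braiding

/-! ### Uniqueness -/

/-- Naturality along the transporters expresses `s.ε ρ σ` by its value on spacelike localized
objects, which the normalization fixes. No other axiom enters. -/
theorem Symmetry.eq_braidingSymmetry (s : Symmetry N)
    (hs : ∀ ρ σ : LTBimod N, SpacelikeLocalized ρ σ →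
      (s.ε ρ σ).mat = LTBimod.theta ρ σ * (ρ.tensor σ).hom 1) : s = braidingSymmetry N := by
  apply Symmetry.ext
  funext ρ σ
  have h := spacelikeLocalized_transport ρ σ
  have hU := ρ.isUnitary_transporter leftCone
  have hV := σ.isUnitary_transporter rightCone
  have h1 : s.ε _ _ = h.exchange := LTBimod.hom_ext (hs _ _ h)
  have h2 := s.naturality (ρ.transporter leftCone) (σ.transporter rightCone)
  rw [h1] at h2
  change s.ε ρ σ = braiding ρ σ
  rw [braiding, ← Category.assoc, h2, Category.assoc, ← LTBimod.tensorHom_comp, hV.comp_adj,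
    hU.comp_adj, LTBimod.tensorHom_id, Category.comp_id]

end

end DHR

open CategoryTheory DHR in
theorem theorem3p5 {H : Type*} [NormedAddCommGroup H] [InnerProductSpace ℂ H] [CompleteSpace H]
    [TopologicalSpace.SeparableSpace H] (hH : ¬ FiniteDimensional ℂ H) (N : ReferenceNet H) :
    ∃ s : Symmetry N,
      -- the normalization on spacelike localized objects
      (∀ ρ σ : LTBimod N, SpacelikeLocalized ρ σ →
        (s.ε ρ σ).mat = LTBimod.theta ρ σ * (ρ.tensor σ).hom 1) ∧
      -- uniqueness
      (∀ s' : Symmetry N,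
        (∀ ρ σ : LTBimod N, SpacelikeLocalized ρ σ →
          (s'.ε ρ σ).mat = LTBimod.theta ρ σ * (ρ.tensor σ).hom 1) → s' = s) ∧
      -- the symmetry is obtained by transporting, along arbitrary unitaries (which exist),
      -- to objects localized in mutually spacelike double cones
      (∀ ρ σ : LTBimod N, ∃ (ρ₁ σ₁ : LTBimod N) (U : ρ ⟶ ρ₁) (V : σ ⟶ σ₁),
        LTBimod.IsUnitary U ∧ LTBimod.IsUnitary V ∧ SpacelikeLocalized ρ₁ σ₁) ∧
      (∀ (ρ σ ρ₁ σ₁ : LTBimod N) (U : ρ ⟶ ρ₁) (V : σ ⟶ σ₁),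
        LTBimod.IsUnitary U → LTBimod.IsUnitary V → SpacelikeLocalized ρ₁ σ₁ →
        (s.ε ρ σ).mat =
          (LTBimod.tensorHom (LTBimod.adj V) (LTBimod.adj U)).mat * LTBimod.theta ρ₁ σ₁ *
            (LTBimod.tensorHom U V).mat) :=
  ⟨braidingSymmetry N,
    fun _ _ h => congrArg LTBimod.Hom.mat h.braiding_eq,
    fun s hs => s.eq_braidingSymmetry hs,
    fun ρ σ => ⟨_, _, _, _, ρ.isUnitary_transporter _, σ.isUnitary_transporter _,
      spacelikeLocalized_transport ρ σ⟩,
    fun _ _ _ _ _ _ hU hV h => braiding_mat hU hV h⟩
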